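/- Let $n\ge 0$, let $D=\mathbb{C}\langle x_1,\dots,x_n,\partial_1,\dots,\partial_n\rangle$ be the Weyl algebra, and put $\theta_j=x_j\partial_j$, $\theta=(\theta_1,\dots,\theta_n)$. Given a finite number $m$ of vectors $A_i\in\mathbb{Z}^n$, numbers $c_i\in\mathbb{C}$ ($i=1,\dots,m$) and $t\in(\mathbb{C}\setminus\{0\})^n$, consider the Ore–Sato coefficient $\varphi(s)=t^s\prod_{i=1}^m\Gamma(\langle A_i,s\rangle+c_i)$, where $t^s=t_1^{s_1}\cdots t_n^{s_n}$, and put $$P_j(s)=t_j\prod_{i:\,A_{i,j}>0}\ \prod_{l=0}^{A_{i,j}-1}(\langle A_i,s\rangle+c_i+l),\qquad Q_j(s)=\prod_{i:\,A_{i,j}<0}\ \prod_{l=0}^{|A_{i,j}|-1}(\langle A_i,s\rangle+c_i+l),$$ so that $\varphi(s+e_j)/\varphi(s)=P_j(s)/Q_j(s+e_j)$. The Horn system $\mathrm{Horn}(\varphi)$ is the system $x_jP_j(\theta)f=Q_j(\theta)f$, $j=1,\dots,n$; its ideal is the left ideal of $D$ generated by the Horn operators $x_jP_j(\theta)-Q_j(\theta)$.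 It is called nonconfluent if $\sum_i A_i=0$. A left ideal $I$ of $D$ is called holonomic if its characteristic variety (the zero set of the principal symbols of the elements of $I$ in $\mathbb{C}^{2n}$) has dimension $n$, and its holonomic rank is $\dim_{\mathbb{C}(x)}\mathbb{C}(x)\otimes_{\mathbb{C}[x]}D/I$. Let $p\in\mathbb{C}[x_1,\dots,x_n]$ be any polynomial. (1) There is an Ore–Sato coefficient $\varphi$ as above, with $m\ge n$, such that $\mathrm{Horn}(\varphi)$ is nonconfluent and holonomic of finite holonomic rank, $p$ is a solution of $\mathrm{Horn}(\varphi)$, and the Horn operators generating the ideal of $\mathrm{Horn}(\varphi)$ commute pairwise. (2) Explicitly, let $S\subset\mathbb{Z}_{\ge0}^n$ be the support of $p$, $\#S$ its cardinality, and $|\alpha|=\alpha_1+\dots+\alpha_n$. For $$\varphi_S(s)=(-1)^{\#S\,(s_1+\dots+s_n)}\prod_{\alpha\in S}\Gamma(s_1+\dots+s_n-|\alpha|)\prod_{j=1}^n\prod_{\alpha\in S}\Gamma(\alpha_j-s_j)$$ (which, up to a factor that is $1$-periodic in each $s_j$, is $\prod_{\alpha\in S}\Gamma(s_1+\dots+s_n-|\alpha|)\big/\prod_{j=1}^n\prod_{\alpha\in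 S}\Gamma(s_j-\alpha_j+1)$), the system $\mathrm{Horn}(\varphi_S)$ is nonconfluent, its ideal is generated by the pairwise commuting operators $$G_j=x_j\prod_{\alpha\in S}(\theta_1+\dots+\theta_n-|\alpha|)-\prod_{\alpha\in S}(\theta_j-\alpha_j),\qquad j=1,\dots,n,$$ it is holonomic of holonomic rank $(\#S)^n$ (with $0^0=1$), and $p$ is a solution of it. -/

import Mathlib

open MvPolynomial TensorProduct

noncomputable section

namespace Horn

/-! ### The Weyl algebra -/

/-- The algebra of operators on `ℂ[x₁,…,xₙ]` generated by the multiplications by the variables and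
by the partial derivatives. -/
def weylSubalgebra (n : ℕ) : Subalgebra ℂ (Module.End ℂ (MvPolynomial (Fin n) ℂ)) :=
  Algebra.adjoin ℂ
    (Set.range (fun j : Fin n => LinearMap.mulLeft ℂ (X j : MvPolynomial (Fin n) ℂ)) ∪
      Set.range (fun j : Fin n => (pderiv j : Derivation ℂ (MvPolynomial (Fin n) ℂ)
        (MvPolynomial (Fin n) ℂ)).toLinearMap))

/-- The `n`-th Weyl algebra `ℂ⟨x₁,…,xₙ,∂₁,…,∂ₙ⟩`: the algebra of differential operators with
coefficients in `ℂ[x₁,…,xₙ]`. -/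
def WeylAlgebra (n : ℕ) : Type := weylSubalgebra n

instance instRingWeyl (n : ℕ) : Ring (WeylAlgebra n) :=
  inferInstanceAs (Ring (weylSubalgebra n))

instance instAlgebraWeyl (n : ℕ) : Algebra ℂ (WeylAlgebra n) :=
  inferInstanceAs (Algebra ℂ (weylSubalgebra n))

/-- The action of differential operators on polynomials. -/
def act (n : ℕ) : WeylAlgebra n →ₐ[ℂ] Module.End ℂ (MvPolynomial (Fin n) ℂ) :=
  (weylSubalgebra n).val

theorem act_injective (n : ℕ) : Function.Injective (act n) :=
  Subtype.val_injective

theorem mulLeft_mem_weylSubalgebra {n : ℕ} (f : MvPolynomial (Fin n) ℂ) :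
    LinearMap.mulLeft ℂ f ∈ weylSubalgebra n := by
  change Algebra.lmul ℂ (MvPolynomial (Fin n) ℂ) f ∈ weylSubalgebra n
  induction f using MvPolynomial.induction_on with
  | C a =>
    rw [← MvPolynomial.algebraMap_eq, AlgHom.commutes]
    exact Subalgebra.algebraMap_mem _ a
  | add f g hf hg =>
    rw [map_add]
    exact add_mem hf hg
  | mul_X f j hf =>
    rw [map_mul]
    exact mul_mem hf (Algebra.subset_adjoin (Or.inl ⟨j, rfl⟩))

/-- A polynomial `f`, regarded as the operator of multiplication by `f`. -/
def mulOp (n : ℕ) : MvPolynomial (Fin n) ℂ →ₐ[ℂ] WeylAlgebra n :=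
  (Algebra.lmul ℂ (MvPolynomial (Fin n) ℂ)).codRestrict (weylSubalgebra n)
    mulLeft_mem_weylSubalgebra

/-- The operator `∂ⱼ`. -/
def dOp {n : ℕ} (j : Fin n) : WeylAlgebra n :=
  ⟨(pderiv j : Derivation ℂ (MvPolynomial (Fin n) ℂ) (MvPolynomial (Fin n) ℂ)).toLinearMap,
    Algebra.subset_adjoin (Or.inr ⟨j, rfl⟩)⟩

theorem act_mulOp {n : ℕ} (f g : MvPolynomial (Fin n) ℂ) : act n (mulOp n f) g = f * g := rfl

theorem act_dOp {n : ℕ} (j : Fin n) (g : MvPolynomial (Fin n) ℂ) :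
    act n (dOp j) g = pderiv j g := rfl

/-- The operator `θⱼ = xⱼ ∂ⱼ`. -/
def thetaOp {n : ℕ} (j : Fin n) : WeylAlgebra n :=
  mulOp n (X j) * dOp j

/-- The operator `P(θ₁,…,θₙ)` for a polynomial `P` (the `θⱼ` commute with each other). -/
def thetaEval {n : ℕ} (P : MvPolynomial (Fin n) ℂ) : WeylAlgebra n :=
  ∑ α ∈ P.support, P.coeff α • (List.ofFn fun j : Fin n => thetaOp j ^ α j).prod

/-- The differential operator with normally ordered total symbol `F = ∑_α a_α(x) ξ^α`, that is
`∑_α a_α(x) ∂^α`. Every element of the Weyl algebra is of this form for a unique `F`. -/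
def normalOp {n : ℕ} (F : MvPolynomial (Fin n) (MvPolynomial (Fin n) ℂ)) : WeylAlgebra n :=
  ∑ α ∈ F.support, mulOp n (F.coeff α) * (List.ofFn fun j : Fin n => dOp j ^ α j).prod

/-! ### Holonomic left ideals and their rank -/

/-- The characteristic ideal of a left ideal `I` of the Weyl algebra, in
`ℂ[x₁,…,xₙ][ξ₁,…,ξₙ]`: it is generated by the principal symbols (with respect to the order of
differential operators) of the elements of `I`. -/
def charIdeal {n : ℕ} (I : Ideal (WeylAlgebra n)) :
    Ideal (MvPolynomial (Fin n) (MvPolynomial (Fin n) ℂ)) :=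
  Ideal.span {σ | ∃ (F : MvPolynomial (Fin n) (MvPolynomial (Fin n) ℂ)) (k : ℕ),
    normalOp F ∈ I ∧ F.totalDegree ≤ k ∧ σ = homogeneousComponent k F}

/-- A left ideal `I` of the Weyl algebra is holonomic if its characteristic variety has
dimension `n`. -/
def IsHolonomic {n : ℕ} (I : Ideal (WeylAlgebra n)) : Prop :=
  ringKrullDim (MvPolynomial (Fin n) (MvPolynomial (Fin n) ℂ) ⧸ charIdeal I) = n

/-- Left multiplication makes the Weyl algebra a module over `ℂ[x₁,…,xₙ]`. -/
instance instModuleWeyl (n : ℕ) : Module (MvPolynomial (Fin n) ℂ) (WeylAlgebra n) :=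
  Module.compHom (WeylAlgebra n) (mulOp n).toRingHom

instance instTowerWeyl (n : ℕ) :
    IsScalarTower (MvPolynomial (Fin n) ℂ) (WeylAlgebra n) (WeylAlgebra n) :=
  ⟨fun f a b => mul_assoc (mulOp n f) a b⟩

/-- The holonomic rank of a left ideal `I` of the Weyl algebra `D`: the dimension over the field
of rational functions `ℂ(x)` of `ℂ(x) ⊗_{ℂ[x]} D/I`. -/
def holonomicRank {n : ℕ} (I : Ideal (WeylAlgebra n)) : Cardinal :=
  Module.rank (FractionRing (MvPolynomial (Fin n) ℂ))
    (FractionRing (MvPolynomial (Fin n) ℂ) ⊗[MvPolynomial (Fin n) ℂ] (WeylAlgebra n ⧸ I))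

/-! ### Ore–Sato coefficients and their Horn systems -/

/-- The data of an Ore–Sato coefficient `φ(s) = t^s ∏ᵢ Γ(⟨Aᵢ, s⟩ + cᵢ)`. -/
structure OreSatoCoeff (n : ℕ) where
  ι : Type
  [fintype : Fintype ι]
  A : ι → Fin n → ℤ
  c : ι → ℂ
  t : Fin n → ℂ
  t_ne_zero : ∀ j, t j ≠ 0

attribute [instance] OreSatoCoeff.fintype

namespace OreSatoCoeff

variable {n : ℕ}

/-- The argument `⟨Aᵢ, s⟩ + cᵢ` of the `i`-th Gamma factor, as a polynomial in `s`. -/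
def linForm (φ : OreSatoCoeff n) (i : φ.ι) : MvPolynomial (Fin n) ℂ :=
  ∑ k, C (φ.A i k : ℂ) * X k + C (φ.c i)

/-- The function `φ(s) = t^s ∏ᵢ Γ(⟨Aᵢ, s⟩ + cᵢ)`. -/
def toFun (φ : OreSatoCoeff n) (s : Fin n → ℂ) : ℂ :=
  (∏ j, φ.t j ^ s j) * ∏ i, Complex.Gamma (eval s (φ.linForm i))

/-- `Pⱼ(s) = tⱼ ∏_{i : A_{ij} > 0} ∏_{l=0}^{A_{ij}-1} (⟨Aᵢ, s⟩ + cᵢ + l)`. -/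
def P (φ : OreSatoCoeff n) (j : Fin n) : MvPolynomial (Fin n) ℂ :=
  C (φ.t j) * ∏ i, ∏ l ∈ Finset.range (φ.A i j).toNat, (φ.linForm i + C (l : ℂ))

/-- `Qⱼ(s) = ∏_{i : A_{ij} < 0} ∏_{l=0}^{|A_{ij}|-1} (⟨Aᵢ, s⟩ + cᵢ + l)`. -/
def Q (φ : OreSatoCoeff n) (j : Fin n) : MvPolynomial (Fin n) ℂ :=
  ∏ i, ∏ l ∈ Finset.range (-φ.A i j).toNat, (φ.linForm i + C (l : ℂ))

theorem eval_linForm_add_single (φ : OreSatoCoeff n) (i : φ.ι) (j : Fin n) (s : Fin n → ℂ) :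
    eval (s + Pi.single j 1) (φ.linForm i) = eval s (φ.linForm i) + φ.A i j := by
  simp [linForm, mul_add, Finset.sum_add_distrib, Pi.single_apply]
  ring

theorem Gamma_add_natCast (a : ℕ) (z : ℂ) (hz : ∀ k : ℕ, z ≠ -k) :
    Complex.Gamma (z + a) = (∏ l ∈ Finset.range a, (z + l)) * Complex.Gamma z := by
  induction a with
  | zero => simp
  | succ a ih =>
    have h : z + a ≠ 0 := fun h => hz a (eq_neg_of_add_eq_zero_left h)
    rw [Finset.prod_range_succ, Nat.cast_succ, ← add_assoc, Complex.Gamma_add_one _ h, ih]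
    ring

/-- The relation `φ(s + eⱼ) / φ(s) = Pⱼ(s) / Qⱼ(s + eⱼ)` off the poles of the Gamma factors:
`Pⱼ` and `Qⱼ` are the polynomials attached to the function `φ`. -/
theorem toFun_add_single (φ : OreSatoCoeff n) (j : Fin n) (s : Fin n → ℂ)
    (h₁ : ∀ (i : φ.ι) (k : ℕ), eval s (φ.linForm i) ≠ -k)
    (h₂ : ∀ (i : φ.ι) (k : ℕ), eval (s + Pi.single j 1) (φ.linForm i) ≠ -k) :
    φ.toFun (s + Pi.single j 1) * eval (s + Pi.single j 1) (φ.Q j) =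
      eval s (φ.P j) * φ.toFun s := by
  have ht : ∏ k, φ.t k ^ (s + Pi.single j 1 : Fin n → ℂ) k = φ.t j * ∏ k, φ.t k ^ s k := by
    have : ∀ k, φ.t k ^ (s + Pi.single j 1 : Fin n → ℂ) k =
        φ.t k ^ s k * (if k = j then φ.t j else 1) := by
      intro k
      rw [Pi.add_apply, Complex.cpow_add _ _ (φ.t_ne_zero k)]
      by_cases hk : k = j
      · subst hk; simp
      · simp [hk]
    rw [Finset.prod_congr rfl fun k _ => this k, Finset.prod_mul_distrib]
    simp [mul_comm]
  have hG : ∀ i, Complex.Gamma (eval (s + Pi.single j 1) (φ.linForm i)) *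
      ∏ l ∈ Finset.range (-φ.A i j).toNat, (eval (s + Pi.single j 1) (φ.linForm i) + l) =
      (∏ l ∈ Finset.range (φ.A i j).toNat, (eval s (φ.linForm i) + l)) *
        Complex.Gamma (eval s (φ.linForm i)) := by
    intro i
    have e := φ.eval_linForm_add_single i j s
    have H₁ := h₁ i
    have H₂ := h₂ i
    rcases le_total 0 (φ.A i j) with h | h
    · obtain ⟨a, ha⟩ := Int.eq_ofNat_of_zero_le h
      rw [ha] at e ⊢
      rw [e, Int.cast_natCast, Gamma_add_natCast a _ H₁]
      simp
    · obtain ⟨a, ha⟩ := Int.eq_ofNat_of_zero_le (neg_nonneg.mpr h)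
      have ha' : φ.A i j = -(a : ℤ) := by omega
      rw [ha'] at e ⊢
      have e' : eval s (φ.linForm i) = eval (s + Pi.single j 1) (φ.linForm i) + a := by
        rw [e]; push_cast; ring
      rw [e', Gamma_add_natCast a _ H₂]
      simp [mul_comm]
  simp only [toFun, P, Q, map_prod, map_mul, map_add, eval_C]
  rw [ht, mul_assoc, ← Finset.prod_mul_distrib, Finset.prod_congr rfl fun i _ => hG i,
    Finset.prod_mul_distrib]
  ring

/-- The `j`-th operator `xⱼ Pⱼ(θ) - Qⱼ(θ)` of the Horn system `Horn(φ)`. -/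
def hornOp (φ : OreSatoCoeff n) (j : Fin n) : WeylAlgebra n :=
  mulOp n (X j) * thetaEval (φ.P j) - thetaEval (φ.Q j)

/-- The left ideal of the Weyl algebra that defines the system `Horn(φ)`. -/
def hornIdeal (φ : OreSatoCoeff n) : Ideal (WeylAlgebra n) :=
  Ideal.span (Set.range φ.hornOp)

/-- `f` is a solution of the system `xⱼ Pⱼ(θ) f = Qⱼ(θ) f`, `j = 1,…,n`. -/
def IsSolution (φ : OreSatoCoeff n) (f : MvPolynomial (Fin n) ℂ) : Prop :=
  ∀ j, X j * act n (thetaEval (φ.P j)) f = act n (thetaEval (φ.Q j)) f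

/-- `φ` and its Horn system are nonconfluent if `∑ᵢ Aᵢ = 0`. -/
def IsNonconfluent (φ : OreSatoCoeff n) : Prop :=
  ∑ i, φ.A i = 0

/-- The Ore–Sato coefficient
`φ_S(s) = (-1)^{#S (s₁+⋯+sₙ)} ∏_{α ∈ S} Γ(s₁+⋯+sₙ-|α|) ∏_{j=1}^n ∏_{α ∈ S} Γ(αⱼ - sⱼ)`
attached to a finite set `S` of exponents. The index `(none, α)` stands for the Gamma factor with
`s₁+⋯+sₙ-|α|`, and `(some j, α)` for the one with `αⱼ - sⱼ`. -/
def ofSupport (S : Finset (Fin n →₀ ℕ)) : OreSatoCoeff n where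
  ι := Option (Fin n) × S
  A i := match i.1 with
    | none => 1
    | some j => -Pi.single j 1
  c i := match i.1 with
    | none => -(i.2.1.degree : ℂ)
    | some j => (i.2.1 j : ℂ)
  t _ := (-1) ^ S.card
  t_ne_zero _ := pow_ne_zero _ (neg_ne_zero.mpr one_ne_zero)

end OreSatoCoeff

/-- The operator `xⱼ ∏_{α ∈ S} (θ₁+⋯+θₙ-|α|) - ∏_{α ∈ S} (θⱼ - αⱼ)`. -/
def supportOp {n : ℕ} (S : Finset (Fin n →₀ ℕ)) (j : Fin n) : WeylAlgebra n :=
  mulOp n (X j) * thetaEval (∏ α ∈ S, (∑ k, X k - C (α.degree : ℂ))) -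
    thetaEval (∏ α ∈ S, (X j - C (α j : ℂ)))

end Horn

end

noncomputable section
namespace Horn

/-! ### The Weyl algebra acting on monomials -/

variable {n : ℕ}

/-! Put N = #S. An operator is determined by its values on monomials, and G_j x^s = T(|s|) x^(s+e_j)
- C_j(s_j) x^s with T(u) = ∏ (u - |α|) and C_j(u) = ∏ (u - α_j). Both coefficients vanish at s = α ∈
S, so G_j kills x^α, hence p. Since T sees only the total degree and C_j only the j-th exponent, the
G_j commute. The Horn operators of φ_S are the G_j up to the sign (-1)^N.

Holonomicity. The N-th symbol of G_j is x_j σ^N - (x_j ξ_j)^N with σ = ∑ x_k ξ_k. In a domain where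
all of these vanish, n well-chosen elements make every x_j and ξ_j algebraic
(`trdeg_le_of_relations`), so the characteristic variety has dimension at most n. Conversely, if S
is nonempty the ideal kills some x^α, which puts the zero section ξ = 0 into the variety. If S is
empty the generators are x_j - 1, and the variety contains the fibre x = 1. The latter rests on
functionals modelled on derivatives of the delta function at that point.

Rank. Write δ = β + Nγ with β_j < N and put E_δ = θ^β G^γ, an operator of order at most |δ|. On x^s
its lowest-degree term is a polynomial in s with leading form ±s^δ, so the E_δ are independent over
ℂ[x] (`linearIndependent_standardOp`). There are as many E_δ as ∂^δ with |δ| ≤ k, so up to torsion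
they span the Weyl algebra. As the G_j commute, E_δ G_j = E_(δ+N e_j): up to torsion the ideal is
spanned by the E_δ with some δ_j ≥ N, and the N^n remaining ones form a basis of the quotient. The
case N = 0 is treated separately. -/

theorem act_ext {P Q : WeylAlgebra n}
    (h : ∀ s : Fin n →₀ ℕ, act n P (monomial s 1) = act n Q (monomial s 1)) : P = Q := by
  apply act_injective
  refine (basisMonomials (Fin n) ℂ).ext fun s => ?_
  simpa using h s

theorem act_thetaOp_monomial (j : Fin n) (s : Fin n →₀ ℕ) :
    act n (thetaOp j) (monomial s 1) = (s j : ℂ) • monomial s 1 := by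
  rw [thetaOp, map_mul, Module.End.mul_apply, act_dOp, act_mulOp, X_mul_pderiv_monomial,
    ← Nat.cast_smul_eq_nsmul ℂ]

theorem act_pow_monomial {P : WeylAlgebra n} {s : Fin n →₀ ℕ} {c : ℂ}
    (h : act n P (monomial s 1) = c • monomial s 1) (k : ℕ) :
    act n (P ^ k) (monomial s 1) = c ^ k • (monomial s 1 : MvPolynomial (Fin n) ℂ) := by
  induction k with
  | zero => simp
  | succ k ih =>
    rw [pow_succ, map_mul, Module.End.mul_apply, h, map_smul, ih, smul_smul, pow_succ, mul_comm]

theorem act_ofFn_prod_monomial (s : Fin n →₀ ℕ) {k : ℕ} (P : Fin k → WeylAlgebra n) (c : Fin k → ℂ)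
    (h : ∀ j, act n (P j) (monomial s 1) = c j • monomial s 1) :
    act n (List.ofFn P).prod (monomial s 1) =
      (∏ j, c j) • (monomial s 1 : MvPolynomial (Fin n) ℂ) := by
  induction k with
  | zero => simp
  | succ k ih =>
    rw [List.ofFn_succ, List.prod_cons, map_mul, Module.End.mul_apply,
      ih _ (fun j => c j.succ) fun j => h j.succ, map_smul, h 0, smul_smul, Fin.prod_univ_succ,
      mul_comm]

theorem act_thetaEval_monomial (P : MvPolynomial (Fin n) ℂ) (s : Fin n →₀ ℕ) :
    act n (thetaEval P) (monomial s 1) =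
      eval (fun j => (s j : ℂ)) P • (monomial s 1 : MvPolynomial (Fin n) ℂ) := by
  rw [thetaEval, map_sum, LinearMap.sum_apply, eval_eq', Finset.sum_smul]
  refine Finset.sum_congr rfl fun α _ => ?_
  rw [map_smul, LinearMap.smul_apply, act_ofFn_prod_monomial s _ (fun j => (s j : ℂ) ^ α j)
    fun j => act_pow_monomial (act_thetaOp_monomial j s) _, smul_smul]

/-- Evaluation of polynomials at `(θ₁,…,θₙ)`, as a homomorphism of algebras. -/
def thetaHom (n : ℕ) : MvPolynomial (Fin n) ℂ →ₐ[ℂ] WeylAlgebra n where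
  toFun := thetaEval
  map_one' := act_ext fun s => by rw [act_thetaEval_monomial]; simp
  map_mul' P Q := act_ext fun s => by
    simp [act_thetaEval_monomial, map_mul, Module.End.mul_apply, map_smul, smul_smul, mul_comm]
  map_zero' := act_ext fun s => by rw [act_thetaEval_monomial]; simp
  map_add' P Q := act_ext fun s => by
    simp [act_thetaEval_monomial, map_add, add_smul]
  commutes' c := act_ext fun s => by
    rw [act_thetaEval_monomial]; simp [Algebra.algebraMap_eq_smul_one]

theorem thetaHom_apply (P : MvPolynomial (Fin n) ℂ) : thetaHom n P = thetaEval P := rfl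

theorem thetaHom_X (j : Fin n) : thetaHom n (X j) = thetaOp j :=
  act_ext fun s => by
    rw [thetaHom_apply, act_thetaEval_monomial, act_thetaOp_monomial, eval_X]

theorem act_mulOp_mul_thetaEval_monomial (P : MvPolynomial (Fin n) ℂ) (j : Fin n) (s : Fin n →₀ ℕ) :
    act n (mulOp n (X j) * thetaEval P) (monomial s 1) =
      eval (fun j => (s j : ℂ)) P • (monomial (s + Finsupp.single j 1) 1) := by
  rw [map_mul, Module.End.mul_apply, act_thetaEval_monomial, map_smul, act_mulOp, mul_comm, X,
    monomial_mul, mul_one]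

/-! ### The operators attached to a finite set of exponents -/

/-- The polynomial `∏_{α ∈ S} (s₁+⋯+sₙ-|α|)`. -/
def totalPoly (S : Finset (Fin n →₀ ℕ)) : MvPolynomial (Fin n) ℂ :=
  ∏ α ∈ S, (∑ k, X k - C (α.degree : ℂ))

/-- The polynomial `∏_{α ∈ S} (sⱼ-αⱼ)`. -/
def coordPoly (S : Finset (Fin n →₀ ℕ)) (j : Fin n) : MvPolynomial (Fin n) ℂ :=
  ∏ α ∈ S, (X j - C (α j : ℂ))

theorem supportOp_eq (S : Finset (Fin n →₀ ℕ)) (j : Fin n) :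
    supportOp S j = mulOp n (X j) * thetaHom n (totalPoly S) - thetaHom n (coordPoly S j) := rfl

theorem act_supportOp_monomial (S : Finset (Fin n →₀ ℕ)) (j : Fin n) (s : Fin n →₀ ℕ) :
    act n (supportOp S j) (monomial s 1) =
      (∏ α ∈ S, ((s.degree : ℂ) - α.degree)) • monomial (s + Finsupp.single j 1) 1 -
        (∏ α ∈ S, ((s j : ℂ) - α j)) • monomial s 1 := by
  rw [supportOp, map_sub, LinearMap.sub_apply, act_mulOp_mul_thetaEval_monomial,
    act_thetaEval_monomial]
  simp [Finsupp.degree_eq_sum]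

/-- On x^s, the coefficient at x_j depends only on |s|, which x_i and x_j raise equally, while the
diagonal coefficient of G_j depends only on s_j, which x_i leaves alone for i ≠ j. Both orders of
composition therefore agree. -/
theorem commute_supportOp (S : Finset (Fin n →₀ ℕ)) (i j : Fin n) :
    Commute (supportOp S i) (supportOp S j) := by
  rcases eq_or_ne i j with rfl | h
  · exact Commute.refl _
  refine act_ext fun s => ?_
  simp only [map_mul, Module.End.mul_apply, act_supportOp_monomial, map_sub, map_smul]
  rw [add_right_comm s (Finsupp.single i 1)]
  simp only [map_add, Finsupp.degree_single, Finsupp.add_apply, Finsupp.single_eq_of_ne h,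
    Finsupp.single_eq_of_ne h.symm, add_zero, smul_sub, smul_smul]
  module

/-! ### The Horn system of φ_S -/

namespace OreSatoCoeff

theorem P_ofSupport (S : Finset (Fin n →₀ ℕ)) (j : Fin n) :
    (ofSupport S).P j = C ((-1) ^ S.card) * totalPoly S := by
  have : ∀ i : (ofSupport S).ι,
      ∏ l ∈ Finset.range ((ofSupport S).A i j).toNat, ((ofSupport S).linForm i + C (l : ℂ)) =
        match i.1 with
        | none => ∑ k, X k - C (i.2.1.degree : ℂ)
        | some _ => 1 := by
    rintro ⟨_ | k, α⟩
    · simp [ofSupport, linForm, sub_eq_add_neg]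
    · have : (-(Pi.single k 1 : Fin n → ℤ) j).toNat = 0 := by
        rw [Pi.single_apply]; split_ifs <;> rfl
      simp [ofSupport, this]
  rw [P, Finset.prod_congr rfl fun i _ => this i]
  change _ * ∏ i : Option (Fin n) × S, _ = _
  rw [Fintype.prod_prod_type, Fintype.prod_option]
  simp only [Finset.prod_const_one, mul_one]
  rw [Finset.prod_coe_sort S fun α => (∑ k, X k - C (α.degree : ℂ) : MvPolynomial (Fin n) ℂ)]
  rfl

/-- The Gamma arguments are α_j - s_j, so each factor contributes a sign. This is the same total
sign that t_j puts into `P`, and it cancels from the Horn equation. -/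
theorem Q_ofSupport (S : Finset (Fin n →₀ ℕ)) (j : Fin n) :
    (ofSupport S).Q j = C ((-1) ^ S.card) * coordPoly S j := by
  have : ∀ i : (ofSupport S).ι,
      ∏ l ∈ Finset.range (-(ofSupport S).A i j).toNat, ((ofSupport S).linForm i + C (l : ℂ)) =
        match i.1 with
        | none => 1
        | some k => if k = j then -1 * (X j - C (i.2.1 j : ℂ)) else 1 := by
    rintro ⟨_ | k, α⟩
    · simp [ofSupport]
    · rcases eq_or_ne k j with rfl | h
      · simp [ofSupport, linForm, Pi.single_apply, neg_add_eq_sub]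
      · simp [ofSupport, h, h.symm]
  rw [Q, Finset.prod_congr rfl fun i _ => this i]
  change ∏ i : Option (Fin n) × S, _ = _
  rw [Fintype.prod_prod_type, Fintype.prod_option, Finset.prod_const_one, one_mul,
    Finset.prod_comm]
  simp only [Finset.prod_ite_eq', Finset.mem_univ, if_true]
  rw [Finset.prod_coe_sort S fun α => (-1 * (X j - C (α j : ℂ)) : MvPolynomial (Fin n) ℂ),
    Finset.prod_mul_distrib, Finset.prod_const]
  simp [coordPoly]

theorem hornOp_ofSupport (S : Finset (Fin n →₀ ℕ)) (j : Fin n) :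
    (ofSupport S).hornOp j = ((-1) ^ S.card : ℂ) • supportOp S j := by
  rw [hornOp, P_ofSupport, Q_ofSupport, C_mul', C_mul', ← thetaHom_apply, ← thetaHom_apply,
    map_smul, map_smul, supportOp_eq, smul_sub, mul_smul_comm]

theorem hornIdeal_ofSupport (S : Finset (Fin n →₀ ℕ)) :
    (ofSupport S).hornIdeal = Ideal.span (Set.range (supportOp S)) := by
  have h1 : ((-1) ^ S.card * (-1) ^ S.card : ℂ) = 1 := by
    rw [← mul_pow]; simp
  apply le_antisymm <;> refine Ideal.span_le.2 ?_ <;> rintro _ ⟨j, rfl⟩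
  · rw [hornOp_ofSupport, Algebra.smul_def]
    exact Ideal.mul_mem_left _ _ (Ideal.subset_span ⟨j, rfl⟩)
  · have : supportOp S j = algebraMap ℂ (WeylAlgebra n) ((-1) ^ S.card) *
        (ofSupport S).hornOp j := by
      rw [hornOp_ofSupport, ← Algebra.smul_def, smul_smul, h1, one_smul]
    rw [this]
    exact Ideal.mul_mem_left _ _ (Ideal.subset_span ⟨j, rfl⟩)

theorem commute_hornOp_ofSupport (S : Finset (Fin n →₀ ℕ)) (i j : Fin n) :
    Commute ((ofSupport S).hornOp i) ((ofSupport S).hornOp j) := by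
  rw [hornOp_ofSupport, hornOp_ofSupport]
  exact ((commute_supportOp S i j).smul_left _).smul_right _

/-- For a monomial x^α of p, both products contain the factor indexed by α, which is zero. -/
theorem act_supportOp_eq_zero {S : Finset (Fin n →₀ ℕ)} {p : MvPolynomial (Fin n) ℂ}
    (hp : p.support ⊆ S) (j : Fin n) : act n (supportOp S j) p = 0 := by
  rw [p.as_sum, map_sum]
  refine Finset.sum_eq_zero fun α hα => ?_
  rw [← mul_one (coeff α p), ← smul_eq_mul, ← smul_monomial, map_smul, act_supportOp_monomial,
    Finset.prod_eq_zero (hp hα) (sub_self _), Finset.prod_eq_zero (hp hα) (sub_self _)]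
  simp

theorem isSolution_ofSupport {S : Finset (Fin n →₀ ℕ)} {p : MvPolynomial (Fin n) ℂ}
    (hp : p.support ⊆ S) : (ofSupport S).IsSolution p := by
  intro j
  have h : act n ((ofSupport S).hornOp j) p = 0 := by
    rw [hornOp_ofSupport, map_smul, LinearMap.smul_apply, act_supportOp_eq_zero hp, smul_zero]
  rw [hornOp, map_sub, map_mul, LinearMap.sub_apply, Module.End.mul_apply, act_mulOp] at h
  exact sub_eq_zero.1 h

theorem isNonconfluent_ofSupport (S : Finset (Fin n →₀ ℕ)) :
    (ofSupport S).IsNonconfluent := by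
  change ∑ i : Option (Fin n) × S, (match i.1 with
    | none => 1
    | some j => -Pi.single j 1 : Fin n → ℤ) = 0
  rw [Fintype.sum_prod_type, Fintype.sum_option, Finset.sum_comm, ← Finset.sum_add_distrib]
  refine Finset.sum_eq_zero fun α _ => ?_
  ext k
  simp [Finset.sum_apply, Pi.single_apply]

theorem card_ofSupport (S : Finset (Fin n →₀ ℕ)) :
    Fintype.card (ofSupport S).ι = (n + 1) * S.card := by
  change Fintype.card (Option (Fin n) × S) = _
  simp

end OreSatoCoeff

/-! ### Top-degree components of products -/

theorem homogeneousComponent_mul_of_totalDegree_le {σ R : Type*} [CommSemiring R]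
    {F G : MvPolynomial σ R} {k l : ℕ} (hF : F.totalDegree ≤ k) (hG : G.totalDegree ≤ l) :
    homogeneousComponent (k + l) (F * G) = homogeneousComponent k F * homogeneousComponent l G := by
  classical
  ext d
  rw [coeff_homogeneousComponent]
  split_ifs with h
  · rw [coeff_mul, coeff_mul]
    refine Finset.sum_congr rfl fun x hx => ?_
    rw [Finset.HasAntidiagonal.mem_antidiagonal] at hx
    have hd : x.1.degree + x.2.degree = k + l := by rw [← map_add, hx, h]
    rw [coeff_homogeneousComponent, coeff_homogeneousComponent]
    rcases lt_trichotomy x.1.degree k with h1 | h1 | h1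
    · have : coeff x.2 G = 0 := coeff_eq_zero_of_totalDegree_lt (by
        rw [← Finsupp.degree_apply]; omega)
      simp [this]
    · have h2 : x.2.degree = l := by omega
      simp [h1, h2]
    · have : coeff x.1 F = 0 := coeff_eq_zero_of_totalDegree_lt (by
        rw [← Finsupp.degree_apply]; omega)
      simp [this]
  · exact (((homogeneousComponent_isHomogeneous k F).mul
      (homogeneousComponent_isHomogeneous l G)).coeff_eq_zero h).symm

/-! ### Normally ordered operators -/

/-- The operator `∂^α`. -/
def dMonomial (α : Fin n →₀ ℕ) : WeylAlgebra n :=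
  (List.ofFn fun j : Fin n => dOp j ^ α j).prod

theorem commute_dOp (i j : Fin n) : Commute (dOp i) (dOp j) := by
  refine act_injective n (LinearMap.ext fun f => ?_)
  simp only [map_mul, Module.End.mul_apply, act_dOp]
  have h : ⁅(pderiv i : Derivation ℂ (MvPolynomial (Fin n) ℂ) (MvPolynomial (Fin n) ℂ)),
      (pderiv j : Derivation ℂ (MvPolynomial (Fin n) ℂ) (MvPolynomial (Fin n) ℂ))⁆ = 0 := by
    refine derivation_ext fun k => ?_
    simp [Derivation.commutator_apply, pderiv_X, Pi.single_apply, apply_ite (pderiv _)]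
  rw [← sub_eq_zero, ← Derivation.commutator_apply, h, Derivation.zero_apply]

theorem prod_ofFn_pow_add {M : Type*} [Monoid M] {k : ℕ} (f : Fin k → M)
    (hf : ∀ i j, Commute (f i) (f j)) (a b : Fin k → ℕ) :
    (List.ofFn fun j => f j ^ (a j + b j)).prod =
      (List.ofFn fun j => f j ^ a j).prod * (List.ofFn fun j => f j ^ b j).prod := by
  induction k with
  | zero => simp
  | succ k ih =>
    have h : Commute (f 0 ^ b 0) (List.ofFn fun j : Fin k => f j.succ ^ a j.succ).prod := by
      refine Commute.list_prod_right _ _ fun x hx => ?_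
      obtain ⟨j, rfl⟩ := (List.mem_ofFn' _ _).1 hx
      exact (hf _ _).pow_pow _ _
    rw [List.ofFn_succ, List.ofFn_succ, List.ofFn_succ, List.prod_cons, List.prod_cons,
      List.prod_cons, ih (fun j => f j.succ) (fun i j => hf _ _), pow_add, mul_assoc, mul_assoc,
      ← mul_assoc (f 0 ^ b 0), h.eq, mul_assoc]

theorem dMonomial_add (α β : Fin n →₀ ℕ) : dMonomial (α + β) = dMonomial α * dMonomial β :=
  prod_ofFn_pow_add _ commute_dOp α β

theorem dMonomial_zero : dMonomial (0 : Fin n →₀ ℕ) = 1 := by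
  simp [dMonomial]

theorem prod_ofFn_pow_single {M : Type*} [Monoid M] {k : ℕ} (f : Fin k → M) (i : Fin k) :
    (List.ofFn fun j => f j ^ (Finsupp.single i 1 : Fin k →₀ ℕ) j).prod = f i := by
  induction k with
  | zero => exact i.elim0
  | succ k ih =>
    rw [List.ofFn_succ, List.prod_cons]
    refine Fin.cases ?_ (fun i => ?_) i
    · simp
    · rw [Finsupp.single_eq_of_ne (Fin.succ_ne_zero i).symm, pow_zero, one_mul,
        ← ih (fun j => f j.succ) i]
      simp [Finsupp.single_apply]

theorem dMonomial_single (i : Fin n) : dMonomial (Finsupp.single i 1) = dOp i :=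
  prod_ofFn_pow_single _ i

theorem dMonomial_add_single (α : Fin n →₀ ℕ) (i : Fin n) :
    dMonomial (α + Finsupp.single i 1) = dOp i * dMonomial α := by
  rw [add_comm, dMonomial_add, dMonomial_single]

theorem dOp_mul_mulOp (j : Fin n) (a : MvPolynomial (Fin n) ℂ) :
    dOp j * mulOp n a = mulOp n a * dOp j + mulOp n (pderiv j a) := by
  refine act_injective n (LinearMap.ext fun f => ?_)
  simp only [map_mul, map_add, Module.End.mul_apply, LinearMap.add_apply, act_dOp, act_mulOp,
    Derivation.leibniz, smul_eq_mul]
  ring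

theorem normalOp_eq_sum {F : MvPolynomial (Fin n) (MvPolynomial (Fin n) ℂ)}
    {T : Finset (Fin n →₀ ℕ)} (hT : F.support ⊆ T) :
    normalOp F = ∑ α ∈ T, mulOp n (F.coeff α) * dMonomial α :=
  Finset.sum_subset hT fun α _ hα => by
    rw [notMem_support_iff.1 hα, map_zero, zero_mul]

/-- The normally ordered operator attached to a total symbol, as an additive map. -/
def normalHom (n : ℕ) : MvPolynomial (Fin n) (MvPolynomial (Fin n) ℂ) →+ WeylAlgebra n where
  toFun := normalOp
  map_zero' := by simp [normalOp]
  map_add' F G := by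
    classical
    rw [normalOp_eq_sum (F := F) (Finset.subset_union_left (s₂ := G.support)),
      normalOp_eq_sum (F := G) (Finset.subset_union_right (s₁ := F.support)),
      normalOp_eq_sum (F := F + G) support_add, ← Finset.sum_add_distrib]
    simp [add_mul]

theorem normalHom_apply (F : MvPolynomial (Fin n) (MvPolynomial (Fin n) ℂ)) :
    normalHom n F = normalOp F := rfl

theorem normalHom_monomial (α : Fin n →₀ ℕ) (a : MvPolynomial (Fin n) ℂ) :
    normalHom n (monomial α a) = mulOp n a * dMonomial α := by
  classical
  rw [normalHom_apply, normalOp_eq_sum support_monomial_subset]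
  simp

theorem normalHom_C_mul (f : MvPolynomial (Fin n) ℂ)
    (F : MvPolynomial (Fin n) (MvPolynomial (Fin n) ℂ)) :
    normalHom n (C f * F) = mulOp n f * normalHom n F := by
  induction F using MvPolynomial.induction_on' with
  | monomial α a => rw [C_mul_monomial, normalHom_monomial, normalHom_monomial, map_mul, mul_assoc]
  | add F G hF hG => rw [mul_add, map_add, map_add, hF, hG, mul_add]

/-- The derivative of a total symbol with respect to `xⱼ`. -/
def coeffPderiv (j : Fin n) (F : MvPolynomial (Fin n) (MvPolynomial (Fin n) ℂ)) :
    MvPolynomial (Fin n) (MvPolynomial (Fin n) ℂ) :=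
  ∑ α ∈ F.support, monomial α (pderiv j (F.coeff α))

theorem totalDegree_coeffPderiv_le (j : Fin n)
    (F : MvPolynomial (Fin n) (MvPolynomial (Fin n) ℂ)) :
    (coeffPderiv j F).totalDegree ≤ F.totalDegree :=
  totalDegree_finsetSum_le fun _ hα =>
    (totalDegree_monomial_le _ _).trans (le_totalDegree hα)

/-- Leibniz rule: moving ∂_j past the coefficients a_α(x) produces ξ_j F plus the x_j-derivative of
F, and the latter does not raise the order. -/
theorem normalHom_X_mul_add_coeffPderiv (j : Fin n)
    (F : MvPolynomial (Fin n) (MvPolynomial (Fin n) ℂ)) :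
    normalHom n (X j * F + coeffPderiv j F) = dOp j * normalHom n F := by
  have h : X j * F + coeffPderiv j F = ∑ α ∈ F.support,
      (monomial (α + Finsupp.single j 1) (F.coeff α) + monomial α (pderiv j (F.coeff α))) := by
    rw [Finset.sum_add_distrib, coeffPderiv]
    congr 1
    conv_lhs => rw [F.as_sum, Finset.mul_sum]
    refine Finset.sum_congr rfl fun α _ => ?_
    rw [X, monomial_mul, one_mul, add_comm]
  rw [h, map_sum, normalHom_apply, normalOp, Finset.mul_sum]
  refine Finset.sum_congr rfl fun α _ => ?_
  rw [map_add, normalHom_monomial, normalHom_monomial, dMonomial_add_single, ← mul_assoc,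
    ← mul_assoc, dOp_mul_mulOp, add_mul]
  rfl

/-! ### Symbols -/

/-- `P` is an operator of order at most `k` with `k`-th symbol `σ`. -/
def HasSymbol (k : ℕ) (σ : MvPolynomial (Fin n) (MvPolynomial (Fin n) ℂ)) (P : WeylAlgebra n) :
    Prop :=
  ∃ F, normalHom n F = P ∧ F.totalDegree ≤ k ∧ homogeneousComponent k F = σ

theorem HasSymbol.mem_charIdeal {k : ℕ} {σ : MvPolynomial (Fin n) (MvPolynomial (Fin n) ℂ)}
    {P : WeylAlgebra n} (h : HasSymbol k σ P) {I : Ideal (WeylAlgebra n)} (hP : P ∈ I) :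
    σ ∈ charIdeal I := by
  obtain ⟨F, rfl, hF, rfl⟩ := h
  exact Ideal.subset_span ⟨F, k, hP, hF, rfl⟩

namespace HasSymbol

variable {k : ℕ} {σ τ : MvPolynomial (Fin n) (MvPolynomial (Fin n) ℂ)} {P Q : WeylAlgebra n}

theorem add (h : HasSymbol k σ P) (h' : HasSymbol k τ Q) : HasSymbol k (σ + τ) (P + Q) := by
  obtain ⟨F, rfl, hF, rfl⟩ := h
  obtain ⟨G, rfl, hG, rfl⟩ := h'
  exact ⟨F + G, map_add _ _ _, (totalDegree_add _ _).trans (max_le hF hG), map_add _ _ _⟩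

theorem sub (h : HasSymbol k σ P) (h' : HasSymbol k τ Q) : HasSymbol k (σ - τ) (P - Q) := by
  obtain ⟨F, rfl, hF, rfl⟩ := h
  obtain ⟨G, rfl, hG, rfl⟩ := h'
  exact ⟨F - G, map_sub _ _ _, (totalDegree_sub _ _).trans (max_le hF hG), map_sub _ _ _⟩

theorem zero (k : ℕ) : HasSymbol k 0 (0 : WeylAlgebra n) :=
  ⟨0, map_zero _, by simp, map_zero _⟩

theorem sum {ι : Type*} (T : Finset ι) {σ : ι → MvPolynomial (Fin n) (MvPolynomial (Fin n) ℂ)}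
    {P : ι → WeylAlgebra n} (h : ∀ i ∈ T, HasSymbol k (σ i) (P i)) :
    HasSymbol k (∑ i ∈ T, σ i) (∑ i ∈ T, P i) := by
  classical
  induction T using Finset.induction_on with
  | empty => exact zero k
  | insert i T hi ih =>
    rw [Finset.sum_insert hi, Finset.sum_insert hi]
    exact (h i (by simp)).add (ih fun j hj => h j (by simp [hj]))

theorem one : HasSymbol 0 1 (1 : WeylAlgebra n) :=
  ⟨1, by rw [← C_1, ← monomial_zero', normalHom_monomial, map_one, dMonomial_zero, mul_one],
    by simp, by simp⟩

theorem mulOp_mul (h : HasSymbol k σ P) (f : MvPolynomial (Fin n) ℂ) :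
    HasSymbol k (C f * σ) (mulOp n f * P) := by
  obtain ⟨F, rfl, hF, rfl⟩ := h
  refine ⟨C f * F, normalHom_C_mul f F, (totalDegree_mul _ _).trans (by simpa using hF), ?_⟩
  rw [homogeneousComponent_C_mul]

theorem succ (h : HasSymbol k σ P) : HasSymbol (k + 1) 0 P := by
  obtain ⟨F, rfl, hF, rfl⟩ := h
  exact ⟨F, rfl, hF.trans k.le_succ, homogeneousComponent_eq_zero _ _ (Nat.lt_succ_of_le hF)⟩

theorem dOp_mul (h : HasSymbol k σ P) (j : Fin n) :
    HasSymbol (k + 1) (X j * σ) (dOp j * P) := by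
  obtain ⟨F, rfl, hF, rfl⟩ := h
  have h1 : (coeffPderiv j F).totalDegree < k + 1 :=
    Nat.lt_succ_of_le ((totalDegree_coeffPderiv_le j F).trans hF)
  have h2 : (X j : MvPolynomial (Fin n) (MvPolynomial (Fin n) ℂ)).totalDegree ≤ 1 :=
    (totalDegree_X j).le
  refine ⟨X j * F + coeffPderiv j F, normalHom_X_mul_add_coeffPderiv j F,
    (totalDegree_add _ _).trans (max_le ((totalDegree_mul _ _).trans (by omega)) h1.le), ?_⟩
  rw [map_add, homogeneousComponent_eq_zero _ _ h1, add_zero, add_comm k,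
    homogeneousComponent_mul_of_totalDegree_le h2 hF,
    homogeneousComponent_of_mem (isHomogeneous_X _ j), if_pos rfl]

theorem thetaOp_mul (h : HasSymbol k σ P) (j : Fin n) :
    HasSymbol (k + 1) (C (X j) * X j * σ) (thetaOp j * P) := by
  rw [thetaOp, mul_assoc, mul_assoc]
  exact (h.dOp_mul j).mulOp_mul _

/-- A scalar does not raise the order, so the constants |α| and α_j do not affect the top symbols of
the products below. -/
theorem thetaHom_C_mul (h : HasSymbol k σ P) (c : ℂ) :
    HasSymbol (k + 1) 0 (thetaHom n (C c) * P) := by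
  have : thetaHom n (C c) = mulOp n (C c) := by
    rw [← algebraMap_eq, AlgHom.commutes, AlgHom.commutes]
  rw [this]
  exact (h.mulOp_mul _).succ

end HasSymbol

/-- The symbol `x₁ξ₁+⋯+xₙξₙ` of `θ₁+⋯+θₙ`. -/
def eulerSymbol (n : ℕ) : MvPolynomial (Fin n) (MvPolynomial (Fin n) ℂ) :=
  ∑ k, C (X k) * X k

theorem hasSymbol_totalPoly (S : Finset (Fin n →₀ ℕ)) :
    HasSymbol S.card (eulerSymbol n ^ S.card) (thetaHom n (totalPoly S)) := by
  classical
  induction S using Finset.induction_on with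
  | empty => simpa [totalPoly] using HasSymbol.one
  | insert α S hα ih =>
    rw [totalPoly, Finset.prod_insert hα, Finset.card_insert_of_notMem hα, map_mul, map_sub,
      sub_mul, map_sum, Finset.sum_mul, pow_succ', ← sub_zero (eulerSymbol n * _)]
    refine HasSymbol.sub ?_ (ih.thetaHom_C_mul _)
    rw [eulerSymbol, Finset.sum_mul]
    exact HasSymbol.sum _ fun k _ => by rw [thetaHom_X]; exact ih.thetaOp_mul k

theorem hasSymbol_coordPoly (S : Finset (Fin n →₀ ℕ)) (j : Fin n) :
    HasSymbol S.card ((C (X j) * X j) ^ S.card) (thetaHom n (coordPoly S j)) := by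
  classical
  induction S using Finset.induction_on with
  | empty => simpa [coordPoly] using HasSymbol.one
  | insert α S hα ih =>
    rw [coordPoly, Finset.prod_insert hα, Finset.card_insert_of_notMem hα, map_mul, map_sub,
      sub_mul, pow_succ', ← sub_zero (C (X j) * X j * _), thetaHom_X]
    exact (ih.thetaOp_mul j).sub (ih.thetaHom_C_mul _)

theorem hasSymbol_supportOp (S : Finset (Fin n →₀ ℕ)) (j : Fin n) :
    HasSymbol S.card (C (X j) * eulerSymbol n ^ S.card - (C (X j) * X j) ^ S.card)
      (supportOp S j) :=
  ((hasSymbol_totalPoly S).mulOp_mul _).sub (hasSymbol_coordPoly S j)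

/-! ### Dimension of affine algebras -/

/-- By Noether normalization A is integral over a polynomial ring in s variables, so dim A ≤ s. That
ring embeds into A/Q for a prime Q lying over zero, so s is at most the transcendence degree of A/Q.
-/
theorem ringKrullDim_le_of_forall_trdeg_le {k A : Type*} [Field k] [CommRing A] [Algebra k A]
    [Algebra.FiniteType k A] {n : ℕ}
    (h : ∀ p : Ideal A, p.IsPrime → Algebra.trdeg k (A ⧸ p) ≤ n) : ringKrullDim A ≤ n := by
  cases subsingleton_or_nontrivial A with
  | inl _ => rw [ringKrullDim_eq_bot_of_subsingleton]; exact bot_le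
  | inr _ =>
    obtain ⟨s, g, hg, hint⟩ := exists_integral_inj_algHom_of_fg k A
    let _ := g.toRingHom.toAlgebra
    have : Algebra.IsIntegral (MvPolynomial (Fin s) k) A := ⟨hint⟩
    have h1 : ringKrullDim A ≤ s := by
      have : ringKrullDim (MvPolynomial (Fin s) k) = s := by
        rw [MvPolynomial.ringKrullDim_of_isNoetherianRing, ringKrullDim_eq_zero_of_field, zero_add,
          Nat.card_fin]
      rw [← this]
      exact Order.krullDim_le_of_strictMono
        (PrimeSpectrum.comap (algebraMap (MvPolynomial (Fin s) k) A))
        fun _ _ hpq => Ideal.IsIntegral.comap_lt_comap hpq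
    obtain ⟨Q, -, hQ, hQ'⟩ := Ideal.exists_ideal_over_prime_of_isIntegral
      (⊥ : Ideal (MvPolynomial (Fin s) k)) (⊥ : Ideal A)
      ((RingHom.injective_iff_ker_eq_bot _).1 hg).le
    have hinj : Function.Injective ((Ideal.Quotient.mkₐ k Q).comp g) := by
      refine (injective_iff_map_eq_zero _).2 fun a ha => ?_
      have : a ∈ Ideal.comap (algebraMap (MvPolynomial (Fin s) k) A) Q :=
        Ideal.Quotient.eq_zero_iff_mem (I := Q) (a := g a).1 ha
      rwa [hQ'] at this
    have h2 := lift_trdeg_le_of_injective _ hinj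
    rw [MvPolynomial.trdeg_of_isDomain] at h2
    have h3 : s ≤ n := by
      have := h2.trans (Cardinal.lift_le.2 (h Q hQ))
      simpa using this
    exact h1.trans (by exact_mod_cast h3)

/-- With y_j = x_j ξ_j and σ = ∑ y_k, the relations say x_j σ^N = y_j^N. If σ = 0 and N > 0, then
x_j or ξ_j vanishes for each j, and the other one serves as generator. If σ ≠ 0, the y_j determine
the x_j rationally, and the ξ_j as well where y_j ≠ 0. Where y_j = 0, ξ_j replaces y_j as generator.
-/
theorem trdeg_le_of_relations {B : Type*} [CommRing B] [IsDomain B] [Algebra ℂ B]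
    (x ξ : Fin n → B) (N : ℕ)
    (hgen : Algebra.adjoin ℂ (Set.range x ∪ Set.range ξ) = ⊤)
    (hrel : ∀ j, x j * (∑ k, x k * ξ k) ^ N = (x j * ξ j) ^ N) :
    Algebra.trdeg ℂ B ≤ n := by
  suffices H : ∃ g : Fin n → B, ∀ j,
      IsAlgebraic (Algebra.adjoin ℂ (Set.range g)) (x j) ∧
      IsAlgebraic (Algebra.adjoin ℂ (Set.range g)) (ξ j) by
    obtain ⟨g, hg⟩ := H
    have : Algebra.IsAlgebraic (Algebra.adjoin ℂ (Set.range g)) B := by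
      refine ⟨fun b => ?_⟩
      have hle : Algebra.adjoin ℂ (Set.range x ∪ Set.range ξ) ≤
          (Subalgebra.algebraicClosure (Algebra.adjoin ℂ (Set.range g)) B).restrictScalars ℂ := by
        refine Algebra.adjoin_le ?_
        rintro _ (⟨j, rfl⟩ | ⟨j, rfl⟩)
        exacts [(hg j).1, (hg j).2]
      rw [hgen] at hle
      exact hle (Algebra.mem_top (x := b))
    refine (Algebra.IsAlgebraic.trdeg_le_cardinalMk ℂ (Set.range g)).trans ?_
    simpa using Cardinal.mk_range_le_lift (f := g)
  have halg (S : Subalgebra ℂ B) {a b z : B} (ha : a ∈ S) (hb : b ∈ S) (h0 : a ≠ 0)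
      (h : a * z = b) : IsAlgebraic S z := by
    refine ⟨Polynomial.C ⟨a, ha⟩ * Polynomial.X - Polynomial.C ⟨b, hb⟩, fun h => h0 ?_, ?_⟩
    · have := congrArg (Polynomial.coeff · 1) h
      simpa [Polynomial.coeff_C] using congrArg Subtype.val this
    · simp [h]
  have hmem (g : Fin n → B) (j : Fin n) : g j ∈ Algebra.adjoin ℂ (Set.range g) :=
    Algebra.subset_adjoin ⟨j, rfl⟩
  have hself (S : Subalgebra ℂ B) {z : B} (hz : z ∈ S) : IsAlgebraic S z :=
    halg S (one_mem _) hz one_ne_zero (one_mul z)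
  rcases Nat.eq_zero_or_pos N with rfl | hN
  -- For N = 0 the relation reads x_j = 1.
  · refine ⟨ξ, fun j => ⟨?_, hself _ (hmem ξ j)⟩⟩
    have := hrel j
    rw [pow_zero, pow_zero, mul_one] at this
    rw [this]
    exact hself _ (one_mem _)
  set σ := ∑ k, x k * ξ k with hσ
  by_cases h0 : σ = 0
  · have hy (j) : x j = 0 ∨ ξ j = 0 := by
      have := hrel j
      rw [h0, zero_pow hN.ne', mul_zero] at this
      exact mul_eq_zero.1 (eq_zero_of_pow_eq_zero this.symm)
    classical
    refine ⟨fun j => if x j = 0 then ξ j else x j, fun j => ?_⟩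
    have h1 := hmem (fun j => if x j = 0 then ξ j else x j) j
    by_cases hx : x j = 0
    · simp only [hx, if_true] at h1
      exact ⟨by rw [hx]; exact hself _ (zero_mem _), hself _ h1⟩
    · simp only [hx, if_false] at h1
      rw [(hy j).resolve_left hx]
      exact ⟨hself _ h1, hself _ (zero_mem _)⟩
  · classical
    set g : Fin n → B := fun j => if x j * ξ j = 0 then ξ j else x j * ξ j with hg
    have hy (j) : x j * ξ j ∈ Algebra.adjoin ℂ (Set.range g) := by
      by_cases h : x j * ξ j = 0
      · rw [h]; exact zero_mem _
      · have := hmem g j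
        simpa only [hg, h, if_false] using this
    have hσ' : σ ^ N ∈ Algebra.adjoin ℂ (Set.range g) :=
      pow_mem (sum_mem fun j _ => hy j) _
    refine ⟨g, fun j => ⟨halg _ hσ' (pow_mem (hy j) N) (pow_ne_zero _ h0) ?_, ?_⟩⟩
    · rw [← hrel j, mul_comm]
    · by_cases h : x j * ξ j = 0
      · have := hmem g j
        simp only [hg, h, if_true] at this
        exact hself _ this
      -- Multiplying the relation by ξ_j gives y_j^N ξ_j = y_j σ^N.
      · refine halg _ (pow_mem (hy j) N) (mul_mem (hy j) hσ') (pow_ne_zero _ h) ?_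
        rw [← hrel j]
        ring

theorem ringKrullDim_quotient_le_of_relations (N : ℕ)
    (J : Ideal (MvPolynomial (Fin n) (MvPolynomial (Fin n) ℂ)))
    (hJ : ∀ j, C (X j) * eulerSymbol n ^ N - (C (X j) * X j) ^ N ∈ J) :
    ringKrullDim (MvPolynomial (Fin n) (MvPolynomial (Fin n) ℂ) ⧸ J) ≤ n := by
  have : Algebra.FiniteType ℂ (MvPolynomial (Fin n) (MvPolynomial (Fin n) ℂ)) :=
    Algebra.FiniteType.trans (S := MvPolynomial (Fin n) ℂ) inferInstance inferInstance
  have : Algebra.FiniteType ℂ (MvPolynomial (Fin n) (MvPolynomial (Fin n) ℂ) ⧸ J) :=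
    Algebra.FiniteType.of_surjective (Ideal.Quotient.mkₐ ℂ J) (Ideal.Quotient.mkₐ_surjective ℂ J)
  refine ringKrullDim_le_of_forall_trdeg_le (k := ℂ)
    (A := MvPolynomial (Fin n) (MvPolynomial (Fin n) ℂ) ⧸ J) fun p hp => ?_
  let f : MvPolynomial (Fin n) (MvPolynomial (Fin n) ℂ) →ₐ[ℂ]
      (MvPolynomial (Fin n) (MvPolynomial (Fin n) ℂ) ⧸ J) ⧸ p :=
    (Ideal.Quotient.mkₐ ℂ p).comp (Ideal.Quotient.mkₐ ℂ J)
  have hf : Function.Surjective f :=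
    (Ideal.Quotient.mkₐ_surjective ℂ p).comp (Ideal.Quotient.mkₐ_surjective ℂ J)
  refine trdeg_le_of_relations (fun j => f (C (X j))) (fun j => f (X j)) N ?_ fun j => ?_
  · refine Algebra.eq_top_iff.2 fun b => ?_
    obtain ⟨F, rfl⟩ := hf b
    induction F using MvPolynomial.induction_on with
    | C a =>
      induction a using MvPolynomial.induction_on with
      | C c => exact Subalgebra.algebraMap_mem _ c
      | add a b ha hb => rw [map_add, map_add]; exact add_mem ha hb
      | mul_X a j ha =>
        rw [map_mul, map_mul]
        exact mul_mem ha (Algebra.subset_adjoin (Or.inl ⟨j, rfl⟩))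
    | add F G hF hG => rw [map_add]; exact add_mem hF hG
    | mul_X F j hF =>
      rw [map_mul]
      exact mul_mem hF (Algebra.subset_adjoin (Or.inr ⟨j, rfl⟩))
  · have h : f (C (X j) * eulerSymbol n ^ N - (C (X j) * X j) ^ N) = 0 := by
      change Ideal.Quotient.mk p (Ideal.Quotient.mk J _) = 0
      rw [Ideal.Quotient.eq_zero_iff_mem.2 (hJ j), map_zero]
    rw [map_sub, sub_eq_zero] at h
    simpa [eulerSymbol] using h

/-! ### Existence and uniqueness of the normally ordered form -/

theorem dOp_mul_mulOp_X (i j : Fin n) :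
    dOp i * mulOp n (X j) = mulOp n (X j) * dOp i + if j = i then 1 else 0 := by
  classical
  rw [dOp_mul_mulOp, pderiv_X, Pi.single_apply]
  split_ifs <;> simp

theorem weylAlgebra_induction {p : WeylAlgebra n → Prop} (one : p 1)
    (add : ∀ P Q, p P → p Q → p (P + Q))
    (mulOp_mul : ∀ f P, p P → p (mulOp n f * P)) (dOp_mul : ∀ j P, p P → p (dOp j * P))
    (P : WeylAlgebra n) : p P := by
  -- In this form the claim passes to products in P, as the induction over the generated subalgebra
  -- needs.
  suffices H : ∀ Q, p Q → p (P * Q) by simpa using H 1 one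
  obtain ⟨P, hP⟩ := P
  induction hP using Algebra.adjoin_induction with
  | mem x hx =>
    rcases hx with ⟨j, rfl⟩ | ⟨j, rfl⟩
    · exact fun Q hQ => mulOp_mul (X j) Q hQ
    · exact fun Q hQ => dOp_mul j Q hQ
  | algebraMap c =>
    intro Q hQ
    have : (⟨algebraMap ℂ _ c, Subalgebra.algebraMap_mem _ c⟩ : WeylAlgebra n) =
        mulOp n (C c) := by
      rw [← algebraMap_eq, AlgHom.commutes]; rfl
    exact this ▸ mulOp_mul (C c) Q hQ
  | add x y hx hy h1 h2 =>
    intro Q hQ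
    exact (congrArg p (add_mul (R := WeylAlgebra n) ⟨x, hx⟩ ⟨y, hy⟩ Q)).mpr
      (add _ _ (h1 Q hQ) (h2 Q hQ))
  | mul x y hx hy h1 h2 =>
    intro Q hQ
    exact (congrArg p (mul_assoc (G := WeylAlgebra n) ⟨x, hx⟩ ⟨y, hy⟩ Q)).mpr (h1 _ (h2 Q hQ))

theorem normalHom_C (a : MvPolynomial (Fin n) ℂ) : normalHom n (C a) = mulOp n a := by
  rw [← monomial_zero', normalHom_monomial, dMonomial_zero, mul_one]

theorem normalHom_surjective : Function.Surjective (normalHom n) := by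
  refine weylAlgebra_induction ⟨C 1, by rw [normalHom_C, map_one]⟩ ?_ ?_ ?_
  · rintro _ _ ⟨F, rfl⟩ ⟨G, rfl⟩
    exact ⟨F + G, map_add _ _ _⟩
  · rintro f _ ⟨F, rfl⟩
    exact ⟨C f * F, normalHom_C_mul f F⟩
  · rintro j _ ⟨F, rfl⟩
    exact ⟨_, normalHom_X_mul_add_coeffPderiv j F⟩

theorem normalHom_mul_X (F : MvPolynomial (Fin n) (MvPolynomial (Fin n) ℂ)) (i : Fin n) :
    normalHom n (F * X i) = normalHom n F * dOp i := by
  induction F using MvPolynomial.induction_on' with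
  | monomial α a =>
    rw [X, monomial_mul, mul_one, normalHom_monomial, normalHom_monomial, dMonomial_add,
      dMonomial_single, mul_assoc]
  | add F G hF hG => rw [add_mul, map_add, map_add, hF, hG, add_mul]

/-- Moving x_j to the left past ∂^α costs α_j ∂^(α-e_j), the ξ_j-derivative of the symbol. -/
theorem normalHom_mul_mulOp_X (F : MvPolynomial (Fin n) (MvPolynomial (Fin n) ℂ)) (j : Fin n) :
    normalHom n F * mulOp n (X j) = normalHom n (C (X j) * F + pderiv j F) := by
  classical
  induction F using MvPolynomial.induction_on with
  | C a =>
    rw [pderiv_C, add_zero, ← C_mul, normalHom_C, normalHom_C, map_mul, ← map_mul, ← map_mul,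
      mul_comm]
  | add F G hF hG =>
    rw [map_add, add_mul, hF, hG, ← map_add]
    congr 1
    rw [map_add]
    ring
  | mul_X F i hF =>
    have e : C (X j) * (F * X i) + pderiv j (F * X i) =
        (C (X j) * F + pderiv j F) * X i + if j = i then F else 0 := by
      rw [pderiv_mul, pderiv_X, Pi.single_apply]
      rcases eq_or_ne j i with rfl | h
      · simp only [if_true]; ring
      · rw [if_neg h, if_neg h.symm]; ring
    rw [e, map_add, normalHom_mul_X, normalHom_mul_X, ← hF, mul_assoc, mul_assoc,
      dOp_mul_mulOp_X, mul_add]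
    split_ifs <;> simp

theorem totalDegree_pderiv_le {R σ : Type*} [CommSemiring R] (F : MvPolynomial σ R) (j : σ)
    {k : ℕ} (h : F.totalDegree ≤ k + 1) : (pderiv j F).totalDegree ≤ k := by
  refine Finset.sup_le fun m hm => ?_
  rw [mem_support_iff, coeff_pderiv] at hm
  have h1 := (le_totalDegree (mem_support_iff.2 (left_ne_zero_of_mul hm))).trans h
  change Finsupp.degree _ ≤ _ at h1
  change Finsupp.degree m ≤ k
  rw [map_add, Finsupp.degree_single] at h1
  omega

/-- The commutator with x_j differentiates the total symbol in ξ_j. If F gives the zero operator, so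
do its ξ-derivatives, which vanish by induction on the degree. In characteristic zero F is then free
of ξ, and acting on 1 recovers it. -/
theorem normalHom_injective : Function.Injective (normalHom n) := by
  refine (injective_iff_map_eq_zero _).2 fun F => ?_
  obtain ⟨k, hk⟩ : ∃ k, F.totalDegree ≤ k := ⟨_, le_rfl⟩
  induction k generalizing F with
  | zero =>
    intro h
    rw [totalDegree_eq_zero_iff_eq_C.1 (Nat.le_zero.1 hk)] at h ⊢
    rw [normalHom_C] at h
    have := congrArg (fun P => act n P 1) h
    simp only [act_mulOp, map_zero, LinearMap.zero_apply, mul_one] at this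
    rw [this, C_0]
  | succ k ih =>
    intro h
    have h0 (j : Fin n) : pderiv j F = 0 := by
      refine ih _ (totalDegree_pderiv_le F j hk) ?_
      have := normalHom_mul_mulOp_X F j
      rw [map_add, normalHom_C_mul, h] at this
      simpa using this.symm
    have hC : F = C (coeff 0 F) := by
      ext1 α
      rw [coeff_C]
      split_ifs with hα
      · rw [hα]
      · obtain ⟨j, hj⟩ := Finsupp.ne_iff.1 (Ne.symm hα)
        rw [Finsupp.zero_apply] at hj
        have h1 : α - Finsupp.single j 1 + Finsupp.single j 1 = α :=
          tsub_add_cancel_of_le (by simpa [Nat.one_le_iff_ne_zero] using hj)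
        have h2 := coeff_pderiv F (α - Finsupp.single j 1) (i := j)
        rw [h0 j, coeff_zero, h1] at h2
        refine (mul_eq_zero.1 h2.symm).resolve_right ?_
        exact Nat.cast_add_one_ne_zero _
    rw [hC] at h ⊢
    rw [normalHom_C] at h
    have := congrArg (fun P => act n P 1) h
    simp only [act_mulOp, map_zero, LinearMap.zero_apply, mul_one] at this
    rw [this, C_0]

/-! ### Lower bounds for the dimension of the characteristic variety -/

theorem ringKrullDim_mvPolynomial_le_of_surjective {R : Type*} [CommRing R] {J : Ideal R}
    (f : R →+* MvPolynomial (Fin n) ℂ) (hf : Function.Surjective f) (hJ : ∀ a ∈ J, f a = 0) :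
    (n : WithBot ℕ∞) ≤ ringKrullDim (R ⧸ J) := by
  have : ringKrullDim (MvPolynomial (Fin n) ℂ) = n := by
    rw [MvPolynomial.ringKrullDim_of_isNoetherianRing, ringKrullDim_eq_zero_of_field, zero_add,
      Nat.card_fin]
  rw [← this]
  exact ringKrullDim_le_of_surjective (Ideal.Quotient.lift J f hJ)
    (Ideal.Quotient.lift_surjective_of_surjective J hJ hf)

/-- The zero section lies in the characteristic variety: a symbol of positive degree vanishes at ξ =
0, and one of degree 0 is an operator a(x) in I, for which a p = 0 forces a = 0. -/
theorem le_ringKrullDim_of_act_eq_zero {I : Ideal (WeylAlgebra n)} {p : MvPolynomial (Fin n) ℂ}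
    (hp : p ≠ 0) (hI : ∀ P ∈ I, act n P p = 0) :
    (n : WithBot ℕ∞) ≤
      ringKrullDim (MvPolynomial (Fin n) (MvPolynomial (Fin n) ℂ) ⧸ charIdeal I) := by
  refine ringKrullDim_mvPolynomial_le_of_surjective constantCoeff
    (fun a => ⟨C a, constantCoeff_C _ a⟩) fun σ hσ => ?_
  refine (Ideal.span_le.2 ?_ : charIdeal I ≤ RingHom.ker constantCoeff) hσ
  rintro _ ⟨F, k, hF, hk, rfl⟩
  rw [SetLike.mem_coe, RingHom.mem_ker, constantCoeff_eq, coeff_homogeneousComponent]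
  split_ifs with h0
  · rw [map_zero] at h0
    subst h0
    rw [totalDegree_eq_zero_iff_eq_C.1 (Nat.le_zero.1 hk), ← normalHom_apply, normalHom_C] at hF
    have := hI _ hF
    rw [act_mulOp] at this
    exact (mul_eq_zero.1 this).resolve_right hp
  · rfl

/-- The substitution `x ↦ x + 1`. -/
def shift (n : ℕ) : MvPolynomial (Fin n) ℂ →ₐ[ℂ] MvPolynomial (Fin n) ℂ :=
  aeval fun j => X j + 1

/-- The functional `F ↦ ∑_α (-∂)^α (a_α g) |_{x = 1}` on total symbols `F = ∑_α a_α(x) ξ^α`, where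
`g` is given as a polynomial in `x - 1`. -/
def deltaHom (g : MvPolynomial (Fin n) ℂ) :
    MvPolynomial (Fin n) (MvPolynomial (Fin n) ℂ) →+ ℂ where
  toFun F := ∑ α ∈ F.support, (-1) ^ α.degree * (∏ j, ((α j).factorial : ℂ)) *
    coeff α (shift n (coeff α F) * g)
  map_zero' := by simp
  map_add' F G := by
    classical
    have h (H : MvPolynomial (Fin n) (MvPolynomial (Fin n) ℂ)) (T : Finset (Fin n →₀ ℕ))
        (hT : H.support ⊆ T) : ∑ α ∈ H.support, (-1) ^ α.degree * (∏ j, ((α j).factorial : ℂ)) *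
          coeff α (shift n (coeff α H) * g) = ∑ α ∈ T, (-1) ^ α.degree *
            (∏ j, ((α j).factorial : ℂ)) * coeff α (shift n (coeff α H) * g) :=
      Finset.sum_subset hT fun α _ hα => by simp [notMem_support_iff.1 hα]
    rw [h F _ Finset.subset_union_left, h G _ Finset.subset_union_right, h (F + G) _ support_add,
      ← Finset.sum_add_distrib]
    simp [add_mul, mul_add]

theorem deltaHom_apply (g : MvPolynomial (Fin n) ℂ)
    (F : MvPolynomial (Fin n) (MvPolynomial (Fin n) ℂ)) :
    deltaHom g F = ∑ α ∈ F.support, (-1) ^ α.degree * (∏ j, ((α j).factorial : ℂ)) *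
      coeff α (shift n (coeff α F) * g) := rfl

theorem deltaHom_monomial (g : MvPolynomial (Fin n) ℂ) (α : Fin n →₀ ℕ)
    (a : MvPolynomial (Fin n) ℂ) :
    deltaHom g (monomial α a) = (-1) ^ α.degree * (∏ j, ((α j).factorial : ℂ)) *
      coeff α (shift n a * g) := by
  classical
  rw [deltaHom_apply, Finset.sum_subset support_monomial_subset]
  · simp
  · intro α _ hα
    simp [notMem_support_iff.1 hα]

theorem prod_factorial_add_single (α : Fin n →₀ ℕ) (j : Fin n) :
    ∏ i, (((α + Finsupp.single j 1 : Fin n →₀ ℕ) i).factorial : ℂ) =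
      (α j + 1) * ∏ i, ((α i).factorial : ℂ) := by
  classical
  have (i : Fin n) : (((α + Finsupp.single j 1 : Fin n →₀ ℕ) i).factorial : ℂ) =
      (if i = j then (α j + 1 : ℂ) else 1) * ((α i).factorial : ℂ) := by
    rcases eq_or_ne i j with rfl | h
    · simp [Nat.factorial_succ]
    · simp [h]
  rw [Finset.prod_congr rfl fun i _ => this i, Finset.prod_mul_distrib]
  simp

/-- The argument is the total symbol of P (x_j - 1) when F is that of P. For F = a ξ^α, the shift
turns x_j - 1 into x_j, lowering the extracted exponent by e_j. The ξ_j-derivative gives the same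
coefficient with opposite sign, its factor α_j being absorbed by the factorials. -/
theorem deltaHom_eq_zero (g : MvPolynomial (Fin n) ℂ) (j : Fin n)
    (F : MvPolynomial (Fin n) (MvPolynomial (Fin n) ℂ)) :
    deltaHom g (C (X j) * F + pderiv j F - F) = 0 := by
  classical
  induction F using MvPolynomial.induction_on' with
  | add F G hF hG =>
    have e : C (X j) * (F + G) + pderiv j (F + G) - (F + G) =
        (C (X j) * F + pderiv j F - F) + (C (X j) * G + pderiv j G - G) := by
      rw [map_add]; ring
    rw [e, map_add, hF, hG, add_zero]
  | monomial α a =>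
    have e : C (X j) * monomial α a + pderiv j (monomial α a) - monomial α a =
        monomial α ((X j - 1) * a) + (α j) • monomial (α - Finsupp.single j 1) a := by
      rw [C_mul_monomial, pderiv_monomial, sub_mul, one_mul, map_sub, smul_monomial, nsmul_eq_mul,
        mul_comm a]
      ring
    have hs : shift n ((X j - 1) * a) * g = X j * (shift n a * g) := by
      rw [map_mul, mul_assoc]
      simp [shift]
    rw [e, map_add, map_nsmul, deltaHom_monomial, deltaHom_monomial, hs]
    by_cases hj : α j = 0
    · rw [coeff_X_mul', if_neg (by simpa using hj), hj]
      simp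
    · obtain ⟨β, rfl⟩ : ∃ β, α = β + Finsupp.single j 1 :=
        ⟨α - Finsupp.single j 1, (tsub_add_cancel_of_le
          (by simpa [Nat.one_le_iff_ne_zero] using hj)).symm⟩
      rw [add_comm β, coeff_X_mul, add_comm _ β, prod_factorial_add_single, add_tsub_cancel_right,
        map_add, Finsupp.degree_single, nsmul_eq_mul, Finsupp.add_apply, Finsupp.single_eq_same]
      push_cast
      ring

/-- The total symbols of the elements of the left ideal generated by the `xⱼ - 1` are annihilated by
the functionals `deltaHom g`. -/
theorem deltaHom_eq_zero_of_mem {g : MvPolynomial (Fin n) ℂ}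
    {F : MvPolynomial (Fin n) (MvPolynomial (Fin n) ℂ)}
    (hF : normalHom n F ∈ Ideal.span (Set.range fun j : Fin n => mulOp n (X j) - 1)) :
    deltaHom g F = 0 := by
  -- The left factor A is carried along so that the scalar case of the span induction is immediate.
  suffices H : ∀ P ∈ Ideal.span (Set.range fun j : Fin n => mulOp n (X j) - 1), ∀ A,
      ∃ F, normalHom n F = A * P ∧ deltaHom g F = 0 by
    obtain ⟨G, hG, h⟩ := H _ hF 1
    rw [one_mul] at hG
    rwa [← normalHom_injective hG]
  intro P hP
  induction hP using Submodule.span_induction with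
  | zero => exact fun A => ⟨0, by rw [mul_zero, map_zero], map_zero _⟩
  | add P Q _ _ hP hQ =>
    intro A
    obtain ⟨F, hF, hF'⟩ := hP A
    obtain ⟨G, hG, hG'⟩ := hQ A
    exact ⟨F + G, by rw [map_add, mul_add, hF, hG], by rw [map_add, hF', hG', add_zero]⟩
  | smul B P _ hP =>
    intro A
    rw [smul_eq_mul, ← mul_assoc]
    exact hP _
  | mem P hP =>
    obtain ⟨j, rfl⟩ := hP
    intro A
    obtain ⟨F, rfl⟩ := normalHom_surjective A
    refine ⟨C (X j) * F + pderiv j F - F, ?_, deltaHom_eq_zero g j F⟩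
    rw [map_sub, ← normalHom_mul_mulOp_X, mul_sub, mul_one]

theorem coeff_shift_zero (a : MvPolynomial (Fin n) ℂ) : coeff 0 (shift n a) = eval 1 a := by
  rw [← constantCoeff_eq]
  induction a using MvPolynomial.induction_on with
  | C c => simp [shift]
  | add a b ha hb => rw [map_add, map_add, map_add, ha, hb]
  | mul_X a j ha => rw [map_mul, map_mul, map_mul, ha]; simp [shift]

theorem eval_coeff_eq_zero_of_mem {F : MvPolynomial (Fin n) (MvPolynomial (Fin n) ℂ)}
    (hF : normalHom n F ∈ Ideal.span (Set.range fun j : Fin n => mulOp n (X j) - 1))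
    {β : Fin n →₀ ℕ} (hβ : F.totalDegree ≤ β.degree) : eval 1 (coeff β F) = 0 := by
  classical
  -- With g = x^β only exponents α ≥ β contribute, and the degree bound leaves α = β alone.
  have h := deltaHom_eq_zero_of_mem (g := monomial β 1) hF
  rw [deltaHom_apply, Finset.sum_eq_single β] at h
  · rw [coeff_mul_monomial', if_pos le_rfl, tsub_self, coeff_shift_zero, mul_one] at h
    refine (mul_eq_zero.1 h).resolve_left (mul_ne_zero (pow_ne_zero _ (by norm_num)) ?_)
    exact Finset.prod_ne_zero_iff.2 fun j _ => Nat.cast_ne_zero.2 (Nat.factorial_ne_zero _)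
  · intro α hα hne
    rw [coeff_mul_monomial', if_neg, mul_zero]
    intro hle
    have h1 : α.degree ≤ β.degree := (le_totalDegree hα).trans hβ
    have h2 : (α - β).degree = 0 := by
      have := congrArg Finsupp.degree (tsub_add_cancel_of_le hle)
      rw [map_add] at this
      omega
    rw [Finsupp.degree_eq_zero_iff, tsub_eq_zero_iff_le] at h2
    exact hne (le_antisymm h2 hle)
  · intro hβ
    simp [notMem_support_iff.1 hβ]

/-- Evaluating the coefficients at x = 1 kills every symbol in the ideal, so the whole fibre over
that point lies in the characteristic variety. -/
theorem le_ringKrullDim_of_eq_span_X_sub_one :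
    (n : WithBot ℕ∞) ≤ ringKrullDim (MvPolynomial (Fin n) (MvPolynomial (Fin n) ℂ) ⧸
      charIdeal (Ideal.span (Set.range fun j : Fin n => mulOp n (X j) - 1))) := by
  refine ringKrullDim_mvPolynomial_le_of_surjective (MvPolynomial.map (eval 1))
    (map_surjective _ fun c => ⟨C c, eval_C c⟩) fun σ hσ => ?_
  refine (Ideal.span_le.2 ?_ : _ ≤ RingHom.ker (MvPolynomial.map (eval 1))) hσ
  rintro _ ⟨F, k, hF, hk, rfl⟩
  rw [SetLike.mem_coe, RingHom.mem_ker]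
  ext β
  rw [coeff_map, coeff_homogeneousComponent, coeff_zero]
  split_ifs with h
  · exact eval_coeff_eq_zero_of_mem hF (h ▸ hk)
  · exact map_zero _

/-! ### Holonomicity -/

theorem isHolonomic_span_supportOp (S : Finset (Fin n →₀ ℕ)) :
    IsHolonomic (Ideal.span (Set.range (supportOp S))) := by
  refine le_antisymm (ringKrullDim_quotient_le_of_relations S.card _ fun j =>
    (hasSymbol_supportOp S j).mem_charIdeal (Ideal.subset_span ⟨j, rfl⟩)) ?_
  rcases S.eq_empty_or_nonempty with rfl | ⟨α, hα⟩
  · have : supportOp (∅ : Finset (Fin n →₀ ℕ)) = fun j => mulOp n (X j) - 1 := by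
      ext1 j
      simp [supportOp_eq, totalPoly, coordPoly]
    rw [this]
    exact le_ringKrullDim_of_eq_span_X_sub_one
  · refine le_ringKrullDim_of_act_eq_zero (p := monomial α 1) (by simp) fun P hP => ?_
    induction hP using Submodule.span_induction with
    | zero => simp
    | add P Q _ _ hP hQ => rw [map_add, LinearMap.add_apply, hP, hQ, add_zero]
    | smul A P _ hP => rw [smul_eq_mul, map_mul, Module.End.mul_apply, hP, map_zero]
    | mem P hP =>
      obtain ⟨j, rfl⟩ := hP
      exact OreSatoCoeff.act_supportOp_eq_zero
        (support_monomial_subset.trans (Finset.singleton_subset_iff.2 hα)) j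

/-! ### Ranks of modules over domains -/

/-- By additivity and finiteness of the ranks, B/A has rank zero, that is, it is torsion. -/
theorem exists_smul_mem_of_rank_le {R M : Type*} [CommRing R] [IsDomain R] [AddCommGroup M]
    [Module R M] {A B : Submodule R M} (hAB : A ≤ B) (h : Module.rank R B ≤ Module.rank R A)
    (hA : Module.rank R A < Cardinal.aleph0) {x : M} (hx : x ∈ B) :
    ∃ a : R, a ≠ 0 ∧ a • x ∈ A := by
  have h1 := rank_quotient_add_rank_of_isDomain (A.submoduleOf B)
  rw [(Submodule.submoduleOfEquivOfLe hAB).rank_eq] at h1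
  have h2 : Module.rank R (B ⧸ A.submoduleOf B) = 0 := by
    refine (Cardinal.add_right_inj_of_lt_aleph0 (γ := Module.rank R A) hA).1 ?_
    rw [zero_add]
    exact le_antisymm (h1.le.trans h) le_add_self
  obtain ⟨a, ha, hax⟩ := rank_eq_zero_iff.1 h2 (Submodule.Quotient.mk ⟨x, hx⟩)
  refine ⟨a, ha, ?_⟩
  rw [← Submodule.Quotient.mk_smul, Submodule.Quotient.mk_eq_zero] at hax
  exact hax

theorem rank_eq_card_of_linearIndependent.{u, v} {R : Type v} {M ι : Type u} [CommRing R]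
    [IsDomain R] [AddCommGroup M] [Module R M] [Fintype ι] {v : ι → M} (hv : LinearIndependent R v)
    (h : ∀ x, ∃ a : R, a ≠ 0 ∧ a • x ∈ Submodule.span R (Set.range v)) :
    Module.rank R M = Fintype.card ι := by
  rw [← rank_quotient_add_rank_of_isDomain (Submodule.span R (Set.range v)), rank_span hv,
    Cardinal.mk_range_eq _ hv.injective, Cardinal.mk_fintype]
  convert zero_add _
  refine rank_eq_zero_iff.2 fun x => ?_
  obtain ⟨x, rfl⟩ := Submodule.Quotient.mk_surjective _ x
  obtain ⟨a, ha, hax⟩ := h x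
  exact ⟨a, ha, by rwa [← Submodule.Quotient.mk_smul, Submodule.Quotient.mk_eq_zero]⟩

/-- Localizing at the nonzero polynomials preserves rank, so denominators can be avoided by working
up to torsion. -/
theorem holonomicRank_eq_rank (I : Ideal (WeylAlgebra n)) :
    holonomicRank I = Module.rank (MvPolynomial (Fin n) ℂ) (WeylAlgebra n ⧸ I) := by
  rw [holonomicRank, IsFractionRing.rank_right_eq (MvPolynomial (Fin n) ℂ)]
  exact IsLocalizedModule.rank_eq (nonZeroDivisors (MvPolynomial (Fin n) ℂ)) le_rfl
    (TensorProduct.mk (MvPolynomial (Fin n) ℂ) (FractionRing (MvPolynomial (Fin n) ℂ))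
      (WeylAlgebra n ⧸ I) 1)

/-! ### The order of a product -/

theorem HasSymbol.of_lt {k m : ℕ} {σ : MvPolynomial (Fin n) (MvPolynomial (Fin n) ℂ)}
    {P : WeylAlgebra n} (h : HasSymbol k σ P) (hkm : k < m) : HasSymbol m 0 P := by
  obtain ⟨F, rfl, hF, rfl⟩ := h
  exact ⟨F, rfl, hF.trans hkm.le, homogeneousComponent_eq_zero _ _ (hF.trans_lt hkm)⟩

theorem HasSymbol.dMonomial_mul {k : ℕ} {σ : MvPolynomial (Fin n) (MvPolynomial (Fin n) ℂ)}
    {P : WeylAlgebra n} (h : HasSymbol k σ P) (α : Fin n →₀ ℕ) :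
    HasSymbol (α.degree + k) (monomial α 1 * σ) (dMonomial α * P) := by
  induction α using Finsupp.induction_linear generalizing k σ P with
  | zero =>
    rw [dMonomial_zero, map_zero, monomial_zero', C_1, one_mul, one_mul, zero_add]
    exact h
  | add α β hα hβ =>
    rw [dMonomial_add, map_add, ← one_mul (1 : MvPolynomial (Fin n) ℂ), ← monomial_mul,
      mul_assoc, mul_assoc, add_assoc]
    exact hα (hβ h)
  | single j m =>
    induction m with
    | zero =>
      rw [Finsupp.single_zero, dMonomial_zero, map_zero, monomial_zero', C_1, one_mul, one_mul,
        zero_add]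
      exact h
    | succ m ih =>
      have := ih.dOp_mul j
      rw [← mul_assoc, ← mul_assoc, ← dMonomial_add_single, X, monomial_mul, mul_one,
        add_comm (Finsupp.single j 1), ← Finsupp.single_add] at this
      rw [Finsupp.degree_single] at this ⊢
      rwa [add_right_comm]

theorem HasSymbol.mul {k l : ℕ} {σ τ : MvPolynomial (Fin n) (MvPolynomial (Fin n) ℂ)}
    {P Q : WeylAlgebra n} (hP : HasSymbol k σ P) (hQ : HasSymbol l τ Q) :
    HasSymbol (k + l) (σ * τ) (P * Q) := by
  obtain ⟨F, rfl, hF, rfl⟩ := hP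
  have h1 : normalHom n F * Q = ∑ α ∈ F.support, mulOp n (coeff α F) * (dMonomial α * Q) := by
    simp only [← mul_assoc, ← Finset.sum_mul]
    rfl
  have h2 : homogeneousComponent k F * τ =
      ∑ α ∈ F.support, homogeneousComponent k (monomial α (coeff α F)) * τ := by
    conv_lhs => rw [F.as_sum, map_sum, Finset.sum_mul]
  rw [h1, h2]
  refine HasSymbol.sum _ fun α hα => ?_
  have h2 : α.degree ≤ k := (le_totalDegree hα).trans hF
  have h3 := (hQ.dMonomial_mul α).mulOp_mul (coeff α F)
  rw [← mul_assoc, C_mul_monomial, mul_one] at h3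
  rcases h2.eq_or_lt with rfl | h2
  · rwa [homogeneousComponent_of_mem (isHomogeneous_monomial _ rfl), if_pos rfl]
  · rw [homogeneousComponent_eq_zero _ _ ((totalDegree_monomial_le _ _).trans_lt h2), zero_mul]
    exact h3.of_lt (by omega)

/-- `P` is a differential operator of order at most `k`. -/
def IsOrderLE (k : ℕ) (P : WeylAlgebra n) : Prop :=
  ∃ σ, HasSymbol k σ P

namespace IsOrderLE

variable {k l : ℕ} {P Q : WeylAlgebra n}

theorem one : IsOrderLE 0 (1 : WeylAlgebra n) := ⟨1, HasSymbol.one⟩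

theorem mul (hP : IsOrderLE k P) (hQ : IsOrderLE l Q) : IsOrderLE (k + l) (P * Q) := by
  obtain ⟨σ, hσ⟩ := hP
  obtain ⟨τ, hτ⟩ := hQ
  exact ⟨σ * τ, hσ.mul hτ⟩

theorem pow (hP : IsOrderLE k P) (m : ℕ) : IsOrderLE (k * m) (P ^ m) := by
  induction m with
  | zero => simpa using one
  | succ m ih => rw [pow_succ, Nat.mul_succ]; exact ih.mul hP

theorem prod_ofFn {m : ℕ} {P : Fin m → WeylAlgebra n} {d : Fin m → ℕ}
    (h : ∀ i, IsOrderLE (d i) (P i)) : IsOrderLE (∑ i, d i) (List.ofFn P).prod := by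
  induction m with
  | zero => simpa using one
  | succ m ih =>
    rw [List.ofFn_succ, List.prod_cons, Fin.sum_univ_succ]
    exact (h 0).mul (ih fun i => h i.succ)

theorem of_le (hP : IsOrderLE k P) (h : k ≤ l) : IsOrderLE l P := by
  obtain ⟨_, F, rfl, hF, -⟩ := hP
  exact ⟨_, F, rfl, hF.trans h, rfl⟩

theorem mem_span (hP : IsOrderLE k P) : P ∈ Submodule.span (MvPolynomial (Fin n) ℂ)
    (dMonomial '' {α : Fin n →₀ ℕ | α.degree ≤ k}) := by
  obtain ⟨_, F, rfl, hF, -⟩ := hP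
  refine Submodule.sum_mem _ fun α hα => ?_
  exact Submodule.smul_mem _ _ (Submodule.subset_span ⟨α, (le_totalDegree hα).trans hF, rfl⟩)

theorem exists_isOrderLE (P : WeylAlgebra n) : ∃ k, IsOrderLE k P := by
  obtain ⟨F, rfl⟩ := normalHom_surjective P
  exact ⟨_, _, F, rfl, le_rfl, rfl⟩

theorem thetaOp (j : Fin n) : IsOrderLE 1 (thetaOp j) := by
  have := HasSymbol.one.thetaOp_mul j
  rw [mul_one] at this
  exact ⟨_, this⟩

end IsOrderLE

/-! ### Leading forms of polynomials -/

/-- `q` has total degree at most `k`, and its homogeneous component of degree `k` is `σ`. -/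
def HasLeadingForm (k : ℕ) (σ q : MvPolynomial (Fin n) ℂ) : Prop :=
  q.totalDegree ≤ k ∧ homogeneousComponent k q = σ

namespace HasLeadingForm

variable {k l : ℕ} {σ τ q r : MvPolynomial (Fin n) ℂ}

theorem mul (hq : HasLeadingForm k σ q) (hr : HasLeadingForm l τ r) :
    HasLeadingForm (k + l) (σ * τ) (q * r) :=
  ⟨(totalDegree_mul _ _).trans (add_le_add hq.1 hr.1), by
    rw [homogeneousComponent_mul_of_totalDegree_le hq.1 hr.1, hq.2, hr.2]⟩

theorem neg (hq : HasLeadingForm k σ q) : HasLeadingForm k (-σ) (-q) :=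
  ⟨(totalDegree_neg q).le.trans hq.1, by rw [map_neg, hq.2]⟩

theorem one : HasLeadingForm 0 1 (1 : MvPolynomial (Fin n) ℂ) :=
  ⟨by simp, by simp⟩

theorem prod {ι : Type*} (T : Finset ι) {k : ι → ℕ} {σ q : ι → MvPolynomial (Fin n) ℂ}
    (h : ∀ i ∈ T, HasLeadingForm (k i) (σ i) (q i)) :
    HasLeadingForm (∑ i ∈ T, k i) (∏ i ∈ T, σ i) (∏ i ∈ T, q i) := by
  classical
  induction T using Finset.induction_on with
  | empty => exact one
  | insert i T hi ih =>
    rw [Finset.sum_insert hi, Finset.prod_insert hi, Finset.prod_insert hi]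
    exact (h i (by simp)).mul (ih fun j hj => h j (by simp [hj]))

theorem pow (h : HasLeadingForm k σ q) (m : ℕ) : HasLeadingForm (m * k) (σ ^ m) (q ^ m) := by
  simpa using prod (Finset.range m) fun _ _ => h

theorem X_sub_C (j : Fin n) (c : ℂ) : HasLeadingForm 1 (X j) (X j - C c) := by
  refine ⟨(totalDegree_sub_C_le _ _).trans (totalDegree_X j).le, ?_⟩
  rw [map_sub, homogeneousComponent_of_mem (isHomogeneous_X _ j), if_pos rfl,
    homogeneousComponent_eq_zero _ _ (by simp), sub_zero]

theorem coordPoly (S : Finset (Fin n →₀ ℕ)) (j : Fin n) :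
    HasLeadingForm S.card (X j ^ S.card) (coordPoly S j) := by
  simpa [Horn.coordPoly] using prod S fun α _ => X_sub_C j (α j : ℂ)

end HasLeadingForm

/-- In a nontrivial relation, the leading monomial of a term of maximal degree cannot cancel. -/
theorem linearIndependent_of_hasLeadingForm {q : (Fin n →₀ ℕ) → MvPolynomial (Fin n) ℂ}
    {c : (Fin n →₀ ℕ) → ℂ} (hc : ∀ δ, c δ ≠ 0)
    (hq : ∀ δ, HasLeadingForm δ.degree (monomial δ (c δ)) (q δ)) : LinearIndependent ℂ q := by
  classical
  refine linearIndependent_iff'.2 fun T a ha => ?_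
  by_contra! H
  obtain ⟨ε, hε, hε'⟩ := H
  obtain ⟨δ, hδ, hmax⟩ := (T.filter fun δ => a δ ≠ 0).exists_max_image Finsupp.degree
    ⟨ε, by simp [hε, hε']⟩
  rw [Finset.mem_filter] at hδ
  have h := congrArg (fun p => coeff δ (homogeneousComponent δ.degree p)) ha
  simp only [map_sum, map_smul, coeff_sum, coeff_smul, map_zero, coeff_zero] at h
  rw [Finset.sum_eq_single_of_mem δ hδ.1, (hq δ).2, coeff_monomial, if_pos rfl, smul_eq_mul] at h
  · exact mul_ne_zero hδ.2 (hc δ) h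
  · intro δ' hδ' hne
    by_cases h0 : a δ' = 0
    · rw [h0, zero_smul]
    rcases (hmax δ' (by simp [hδ', h0])).eq_or_lt with h1 | h1
    · rw [← h1, (hq δ').2, coeff_monomial, if_neg hne, smul_zero]
    · rw [homogeneousComponent_eq_zero _ _ ((hq δ').1.trans_lt h1), coeff_zero, smul_zero]

/-! ### Operators that do not lower the degree of monomials -/

/-- `P x^s = x^s (q(s) + ⋯)` for all `s`, where the dots stand for terms of positive degree. -/
def IsDiag (P : WeylAlgebra n) (q : MvPolynomial (Fin n) ℂ) : Prop :=
  ∀ s : Fin n →₀ ℕ, ∃ h, act n P (monomial s 1) = monomial s 1 * h ∧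
    constantCoeff h = eval (fun j => (s j : ℂ)) q

namespace IsDiag

variable {P Q : WeylAlgebra n} {q r : MvPolynomial (Fin n) ℂ}

/-- Nonconstant monomials of f only contribute in positive degree relative to x^s. Hence the
diagonal parts of a product multiply. -/
theorem act_monomial_mul (hP : IsDiag P q) (s : Fin n →₀ ℕ) (f : MvPolynomial (Fin n) ℂ) :
    ∃ h, act n P (monomial s 1 * f) = monomial s 1 * h ∧
      constantCoeff h = constantCoeff f * eval (fun j => (s j : ℂ)) q := by
  classical
  induction f using MvPolynomial.induction_on' with
  | monomial α a =>
    obtain ⟨h, h1, h2⟩ := hP (s + α)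
    refine ⟨monomial α a * h, ?_, ?_⟩
    · rw [monomial_mul, one_mul, ← mul_assoc, monomial_mul, one_mul, ← mul_one a, ← smul_eq_mul,
        ← smul_monomial, map_smul, h1, smul_mul_assoc]
    · rw [map_mul, h2, constantCoeff_monomial]
      split_ifs with hα
      · rw [hα, add_zero]
      · rw [zero_mul, zero_mul]
  | add f g hf hg =>
    obtain ⟨h1, h2, h3⟩ := hf
    obtain ⟨h1', h2', h3'⟩ := hg
    exact ⟨h1 + h1', by rw [mul_add, map_add, h2, h2', mul_add],
      by rw [map_add, map_add, h3, h3', add_mul]⟩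

theorem mul (hP : IsDiag P q) (hQ : IsDiag Q r) : IsDiag (P * Q) (q * r) := by
  intro s
  obtain ⟨f, h1, h2⟩ := hQ s
  obtain ⟨h, h3, h4⟩ := hP.act_monomial_mul s f
  refine ⟨h, by rw [map_mul, Module.End.mul_apply, h1, h3], ?_⟩
  rw [h4, h2, map_mul, mul_comm]

theorem one : IsDiag (1 : WeylAlgebra n) 1 := fun s => ⟨1, by simp, by simp⟩

theorem pow (hP : IsDiag P q) (m : ℕ) : IsDiag (P ^ m) (q ^ m) := by
  induction m with
  | zero => simpa using one
  | succ m ih => rw [pow_succ, pow_succ]; exact ih.mul hP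

theorem prod_ofFn {m : ℕ} {P : Fin m → WeylAlgebra n} {q : Fin m → MvPolynomial (Fin n) ℂ}
    (h : ∀ i, IsDiag (P i) (q i)) : IsDiag (List.ofFn P).prod (∏ i, q i) := by
  induction m with
  | zero => simpa using one
  | succ m ih =>
    rw [List.ofFn_succ, List.prod_cons, Fin.prod_univ_succ]
    exact (h 0).mul (ih fun i => h i.succ)

theorem thetaOp (j : Fin n) : IsDiag (thetaOp j) (X j) := fun s =>
  ⟨C (s j : ℂ), by rw [act_thetaOp_monomial, mul_comm, C_mul'], by simp⟩

theorem supportOp (S : Finset (Fin n →₀ ℕ)) (j : Fin n) :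
    IsDiag (supportOp S j) (-coordPoly S j) := by
  intro s
  refine ⟨C (∏ α ∈ S, ((s.degree : ℂ) - α.degree)) * X j - C (∏ α ∈ S, ((s j : ℂ) - α j)), ?_, ?_⟩
  · rw [act_supportOp_monomial, mul_sub, mul_left_comm, mul_comm _ (C _), X, monomial_mul, one_mul,
      C_mul', C_mul']
  · simp [coordPoly]

end IsDiag

/-- Apply a relation ∑ c_δ e_δ = 0 to x^s, cancel x^s and compare coefficients at x^a. Once all
coefficients of the c_δ of degree below |a| vanish, what remains is ∑ coeff_a(c_δ) q_δ(s) = 0 for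
every s, a relation among the q_δ. -/
theorem linearIndependent_of_isDiag {e : (Fin n →₀ ℕ) → WeylAlgebra n}
    {q : (Fin n →₀ ℕ) → MvPolynomial (Fin n) ℂ} (he : ∀ δ, IsDiag (e δ) (q δ))
    (hq : LinearIndependent ℂ q) : LinearIndependent (MvPolynomial (Fin n) ℂ) e := by
  classical
  refine linearIndependent_iff'.2 fun T c hc => ?_
  choose h h1 h2 using he
  have h3 (s : Fin n →₀ ℕ) : ∑ δ ∈ T, c δ * h δ s = 0 := by
    have := congrArg (fun P => act n P (monomial s 1)) hc
    simp only [map_sum, LinearMap.sum_apply, map_zero, LinearMap.zero_apply] at this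
    have h4 (δ) : act n (c δ • e δ) (monomial s 1) = monomial s 1 * (c δ * h δ s) := by
      change act n (mulOp n (c δ) * e δ) (monomial s 1) = _
      rw [map_mul, Module.End.mul_apply, h1, act_mulOp, mul_left_comm]
    simp only [h4, ← Finset.mul_sum] at this
    exact (mul_eq_zero.1 this).resolve_left (by simp)
  suffices H : ∀ (m : ℕ) (a : Fin n →₀ ℕ), a.degree = m → ∀ δ ∈ T, coeff a (c δ) = 0 by
    intro δ hδ
    ext a
    exact H _ a rfl δ hδ
  intro m
  induction m using Nat.strong_induction_on with
  | _ m ih =>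
  intro a ha
  refine linearIndependent_iff'.1 hq T (fun δ => coeff a (c δ)) ?_
  -- A polynomial vanishing on ℕ^n is zero.
  refine funext_set (fun _ => Set.range ((↑) : ℕ → ℂ))
    (fun _ => Set.infinite_range_of_injective Nat.cast_injective) fun x hx => ?_
  choose s hs using fun j => hx j (Set.mem_univ j)
  obtain rfl : (fun j => (s j : ℂ)) = x := funext hs
  have h5 := congrArg (coeff a) (h3 (Finsupp.equivFunOnFinite.symm s))
  rw [coeff_sum, coeff_zero] at h5
  rw [map_sum, map_zero, ← h5]
  refine Finset.sum_congr rfl fun δ hδ => ?_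
  rw [coeff_mul, Finset.sum_eq_single (a, 0), smul_eval]
  · congr 1
    exact (h2 δ (Finsupp.equivFunOnFinite.symm s)).symm
  · rintro ⟨b, r⟩ hbr hne
    rw [Finset.HasAntidiagonal.mem_antidiagonal] at hbr
    have h6 : b.degree + r.degree = m := by rw [← map_add, hbr, ha]
    rw [ih b.degree ?_ b rfl δ hδ, zero_mul]
    refine lt_of_le_of_ne (by omega) fun h7 => hne ?_
    have h8 : r = 0 := (Finsupp.degree_eq_zero_iff r).1 (by omega)
    rw [h8, add_zero] at hbr
    rw [h8]
    exact Prod.ext hbr rfl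
  · intro h
    simp at h

/-! ### A basis of the Weyl algebra up to torsion -/

/-- The product of powers of the commuting operators `supportOp S j`. -/
def supportMonomial (S : Finset (Fin n →₀ ℕ)) (γ : Fin n → ℕ) : WeylAlgebra n :=
  (List.ofFn fun j => supportOp S j ^ γ j).prod

/-- The operator `∏ⱼ θⱼ^{βⱼ} ∏ⱼ Gⱼ^{γⱼ}`, where `Gⱼ = supportOp S j` and `δ = β + #S γ` with
`βⱼ < #S`. -/
def standardOp (S : Finset (Fin n →₀ ℕ)) (δ : Fin n →₀ ℕ) : WeylAlgebra n :=
  (List.ofFn fun j => thetaOp j ^ (δ j % S.card)).prod *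
    supportMonomial S fun j => δ j / S.card

theorem sum_mod_add_sum_div (N : ℕ) (δ : Fin n →₀ ℕ) :
    ∑ j, δ j % N + ∑ j, δ j / N * N = δ.degree := by
  rw [← Finset.sum_add_distrib, Finsupp.degree_eq_sum]
  exact Finset.sum_congr rfl fun j _ => by rw [mul_comm, Nat.mod_add_div]

theorem isOrderLE_supportOp (S : Finset (Fin n →₀ ℕ)) (j : Fin n) :
    IsOrderLE S.card (supportOp S j) :=
  ⟨_, hasSymbol_supportOp S j⟩

theorem isOrderLE_standardOp (S : Finset (Fin n →₀ ℕ)) (δ : Fin n →₀ ℕ) :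
    IsOrderLE δ.degree (standardOp S δ) := by
  rw [← sum_mod_add_sum_div S.card δ]
  refine (IsOrderLE.prod_ofFn fun j => ?_).mul (IsOrderLE.prod_ofFn fun j => ?_)
  · simpa using (IsOrderLE.thetaOp j).pow (δ j % S.card)
  · simpa [mul_comm] using (isOrderLE_supportOp S j).pow (δ j / S.card)

theorem linearIndependent_standardOp (S : Finset (Fin n →₀ ℕ)) :
    LinearIndependent (MvPolynomial (Fin n) ℂ) (standardOp S) := by
  refine linearIndependent_of_isDiag (fun δ => (IsDiag.prod_ofFn fun j =>
    (IsDiag.thetaOp j).pow (δ j % S.card)).mul (IsDiag.prod_ofFn fun j =>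
      (IsDiag.supportOp S j).pow (δ j / S.card))) ?_
  -- The diagonal part of G_j is -∏ (s_j - α_j), which explains the signs.
  refine linearIndependent_of_hasLeadingForm (c := fun δ => ∏ j, (-1) ^ (δ j / S.card))
    (fun δ => Finset.prod_ne_zero_iff.2 fun j _ => pow_ne_zero _ (by norm_num)) fun δ => ?_
  have h1 := (HasLeadingForm.prod Finset.univ fun j _ =>
    (HasLeadingForm.X_sub_C j 0).pow (δ j % S.card)).mul (HasLeadingForm.prod Finset.univ
      fun j _ => (HasLeadingForm.coordPoly S j).neg.pow (δ j / S.card))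
  simp only [C_0, sub_zero, mul_one, sum_mod_add_sum_div] at h1
  convert h1 using 1
  rw [← Finset.prod_mul_distrib, monomial_eq, Finsupp.prod_fintype _ _ (by simp), map_prod,
    ← Finset.prod_mul_distrib]
  refine Finset.prod_congr rfl fun j _ => ?_
  rw [neg_pow (X j ^ S.card : MvPolynomial (Fin n) ℂ), ← pow_mul, mul_left_comm, ← pow_add, Nat.mod_add_div]
  simp

/-- Commutativity lets the new G_j join the others: β is unchanged and γ_j grows by one. This needs
#S > 0, because division by 0 returns 0. -/
theorem standardOp_mul_supportOp {S : Finset (Fin n →₀ ℕ)} (hS : S.Nonempty) (δ : Fin n →₀ ℕ)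
    (j : Fin n) : standardOp S δ * supportOp S j = standardOp S (δ + Finsupp.single j S.card) := by
  have h : (supportMonomial S fun i => δ i / S.card) * supportOp S j =
      supportMonomial S fun i => (δ + Finsupp.single j S.card : Fin n →₀ ℕ) i / S.card := by
    have h1 := prod_ofFn_pow_add (supportOp S) (commute_supportOp S) (fun i => δ i / S.card)
      (Finsupp.single j 1 : Fin n →₀ ℕ)
    rw [prod_ofFn_pow_single] at h1
    rw [supportMonomial, ← h1, supportMonomial]
    congr 2
    ext1 i
    congr 1
    rcases eq_or_ne i j with rfl | hi
    · simp [Nat.add_div_right _ hS.card_pos]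
    · simp [hi]
  rw [standardOp, standardOp, mul_assoc, h]
  congr 3
  ext1 i
  congr 1
  rcases eq_or_ne i j with rfl | hi
  · simp
  · simp [hi]

/-- Operators of order at most k lie in the span of the ∂^α with |α| ≤ k. The equally many
independent standard operators with |δ| ≤ k lie there too, so they span a submodule of full rank. -/
theorem exists_smul_mem_span_standardOp (S : Finset (Fin n →₀ ℕ)) (P : WeylAlgebra n) :
    ∃ f : MvPolynomial (Fin n) ℂ, f ≠ 0 ∧
      f • P ∈ Submodule.span (MvPolynomial (Fin n) ℂ) (Set.range (standardOp S)) := by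
  obtain ⟨k, hk⟩ := IsOrderLE.exists_isOrderLE P
  have hfin : {α : Fin n →₀ ℕ | α.degree ≤ k}.Finite := Finsupp.finite_of_degree_le k
  have hcard : Module.rank (MvPolynomial (Fin n) ℂ) (Submodule.span (MvPolynomial (Fin n) ℂ)
      (standardOp S '' {α : Fin n →₀ ℕ | α.degree ≤ k})) =
      Cardinal.mk {α : Fin n →₀ ℕ | α.degree ≤ k} := by
    rw [rank_span_set ((linearIndependent_standardOp S).linearIndepOn _).id_image,
      Cardinal.mk_image_eq (linearIndependent_standardOp S).injective]
  obtain ⟨f, hf, hf'⟩ := exists_smul_mem_of_rank_le (x := P)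
    (A := Submodule.span (MvPolynomial (Fin n) ℂ)
      (standardOp S '' {α : Fin n →₀ ℕ | α.degree ≤ k}))
    (B := Submodule.span (MvPolynomial (Fin n) ℂ)
      (dMonomial '' {α : Fin n →₀ ℕ | α.degree ≤ k}))
    (Submodule.span_le.2 (by
      rintro _ ⟨δ, hδ, rfl⟩
      exact ((isOrderLE_standardOp S δ).of_le hδ).mem_span))
    (by
      rw [hcard]
      exact (rank_span_le _).trans Cardinal.mk_image_le)
    (by rw [hcard]; exact hfin.lt_aleph0)
    hk.mem_span
  exact ⟨f, hf, Submodule.span_mono (Set.image_subset_range _ _) hf'⟩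

/-! ### The holonomic rank -/

theorem standardOp_mem_span_supportOp {S : Finset (Fin n →₀ ℕ)} (hS : S.Nonempty)
    {δ : Fin n →₀ ℕ} {j : Fin n} (hj : S.card ≤ δ j) :
    standardOp S δ ∈ Ideal.span (Set.range (supportOp S)) := by
  have h : δ - Finsupp.single j S.card + Finsupp.single j S.card = δ :=
    tsub_add_cancel_of_le (by simpa using hj)
  rw [← h, ← standardOp_mul_supportOp hS]
  exact Ideal.mul_mem_left _ _ (Ideal.subset_span ⟨j, rfl⟩)

theorem exists_smul_mem_span_of_mem {S : Finset (Fin n →₀ ℕ)} (hS : S.Nonempty)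
    {P : WeylAlgebra n} (hP : P ∈ Ideal.span (Set.range (supportOp S))) :
    ∃ f : MvPolynomial (Fin n) ℂ, f ≠ 0 ∧ f • P ∈ Submodule.span (MvPolynomial (Fin n) ℂ)
      (standardOp S '' {δ | ∃ j, S.card ≤ δ j}) := by
  suffices H : ∀ A : WeylAlgebra n, ∃ f : MvPolynomial (Fin n) ℂ, f ≠ 0 ∧
      f • (A * P) ∈ Submodule.span (MvPolynomial (Fin n) ℂ)
        (standardOp S '' {δ | ∃ j, S.card ≤ δ j}) by simpa using H 1
  induction hP using Submodule.span_induction with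
  | zero => exact fun A => ⟨1, one_ne_zero, by rw [mul_zero, smul_zero]; exact zero_mem _⟩
  | add P Q _ _ hP hQ =>
    intro A
    obtain ⟨f, hf, hf'⟩ := hP A
    obtain ⟨g, hg, hg'⟩ := hQ A
    refine ⟨f * g, mul_ne_zero hf hg, ?_⟩
    rw [mul_add, smul_add, mul_smul f g (A * Q), mul_comm f, mul_smul g f]
    exact add_mem (Submodule.smul_mem _ _ hf') (Submodule.smul_mem _ _ hg')
  | smul B P _ hP =>
    intro A
    rw [smul_eq_mul, ← mul_assoc]
    exact hP _
  | mem P hP =>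
    obtain ⟨j, rfl⟩ := hP
    intro A
    -- In A G_j only the left factor is expanded; each standard operator in it then has δ_j raised
    -- by #S.
    obtain ⟨f, hf, hf'⟩ := exists_smul_mem_span_standardOp S A
    refine ⟨f, hf, ?_⟩
    rw [← smul_mul_assoc]
    generalize f • A = B at hf' ⊢
    induction hf' using Submodule.span_induction with
    | zero => rw [zero_mul]; exact zero_mem _
    | add P Q _ _ hP hQ => rw [add_mul]; exact add_mem hP hQ
    | smul g P _ hP => rw [smul_mul_assoc]; exact Submodule.smul_mem _ _ hP
    | mem P hP =>
      obtain ⟨δ, rfl⟩ := hP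
      rw [standardOp_mul_supportOp hS]
      exact Submodule.subset_span ⟨_, ⟨j, by simp⟩, rfl⟩

/-- The exponents `β` with `βⱼ < N`, as finitely supported functions. -/
def boxExponent (N : ℕ) (β : Fin n → Fin N) : Fin n →₀ ℕ :=
  Finsupp.equivFunOnFinite.symm fun j => (β j : ℕ)

theorem boxExponent_injective (N : ℕ) :
    Function.Injective (boxExponent N : (Fin n → Fin N) → Fin n →₀ ℕ) := by
  intro β β' h
  ext j
  exact DFunLike.congr_fun h j

/-- A relation modulo the ideal has a nonzero multiple in two spans, over the δ inside the box and
over those outside. These meet in zero by independence. -/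
theorem linearIndependent_mk_standardOp {S : Finset (Fin n →₀ ℕ)} (hS : S.Nonempty) :
    LinearIndependent (MvPolynomial (Fin n) ℂ) fun β : Fin n → Fin S.card =>
      (Submodule.Quotient.mk (standardOp S (boxExponent S.card β)) :
        WeylAlgebra n ⧸ Ideal.span (Set.range (supportOp S))) := by
  refine Fintype.linearIndependent_iff.2 fun c hc => ?_
  have hli : LinearIndependent (MvPolynomial (Fin n) ℂ) fun β : Fin n → Fin S.card =>
      standardOp S (boxExponent S.card β) :=
    (linearIndependent_standardOp S).comp _ (boxExponent_injective _)
  have hc' : ∑ β, c β • standardOp S (boxExponent S.card β) ∈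
      Ideal.span (Set.range (supportOp S)) := by
    rw [← Submodule.Quotient.mk_eq_zero, ← hc, ← Submodule.mkQ_apply, map_sum]
    rfl
  obtain ⟨f, hf, hf'⟩ := exists_smul_mem_span_of_mem hS hc'
  have hdisj := (linearIndependent_standardOp S).disjoint_span_image
    (s := Set.range (boxExponent S.card)) (t := {δ | ∃ j, S.card ≤ δ j}) (by
      rw [Set.disjoint_left]
      rintro _ ⟨β, rfl⟩ ⟨j, hj⟩
      exact absurd hj (not_le.2 (β j).2))
  have h0 := Submodule.disjoint_def.1 hdisj _ (Submodule.smul_mem _ f (Submodule.sum_mem _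
    fun β _ => Submodule.smul_mem _ (c β) (Submodule.subset_span ⟨_, ⟨β, rfl⟩, rfl⟩))) hf'
  rw [Finset.smul_sum] at h0
  simp only [smul_smul] at h0
  exact fun β => (mul_eq_zero.1 (Fintype.linearIndependent_iff.1 hli _ h0 β)).resolve_left hf

theorem holonomicRank_span_supportOp_of_nonempty {S : Finset (Fin n →₀ ℕ)} (hS : S.Nonempty) :
    holonomicRank (Ideal.span (Set.range (supportOp S))) = ((S.card ^ n : ℕ) : Cardinal) := by
  rw [holonomicRank_eq_rank, rank_eq_card_of_linearIndependent (linearIndependent_mk_standardOp hS)]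
  · simp
  intro x
  obtain ⟨P, rfl⟩ := Submodule.Quotient.mk_surjective _ x
  obtain ⟨f, hf, hf'⟩ := exists_smul_mem_span_standardOp S P
  refine ⟨f, hf, ?_⟩
  rw [← Submodule.Quotient.mk_smul]
  generalize f • P = Q at hf' ⊢
  induction hf' using Submodule.span_induction with
  | zero => rw [Submodule.Quotient.mk_zero]; exact zero_mem _
  | add P Q _ _ hP hQ => rw [Submodule.Quotient.mk_add]; exact add_mem hP hQ
  | smul g P _ hP => rw [Submodule.Quotient.mk_smul]; exact Submodule.smul_mem _ _ hP
  | mem P hP =>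
    obtain ⟨δ, rfl⟩ := hP
    by_cases h : ∃ j, S.card ≤ δ j
    · obtain ⟨j, hj⟩ := h
      rw [(Submodule.Quotient.mk_eq_zero _).2 (standardOp_mem_span_supportOp hS hj)]
      exact zero_mem _
    · push Not at h
      refine Submodule.subset_span ⟨fun j => ⟨δ j, h j⟩, ?_⟩
      dsimp only
      congr 2
      ext j
      rfl

/-- If some nonzero polynomial lies in a left ideal, then every operator is torsion modulo this
ideal. -/
theorem exists_smul_mem_of_mulOp_mem {I : Ideal (WeylAlgebra n)} {a : MvPolynomial (Fin n) ℂ}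
    (ha : a ≠ 0) (haI : mulOp n a ∈ I) (P : WeylAlgebra n) :
    ∃ f : MvPolynomial (Fin n) ℂ, f ≠ 0 ∧ mulOp n f * P ∈ I := by
  induction P using weylAlgebra_induction with
  | one => exact ⟨a, ha, by rwa [mul_one]⟩
  | add P Q hP hQ =>
    obtain ⟨f, hf, hf'⟩ := hP
    obtain ⟨g, hg, hg'⟩ := hQ
    refine ⟨f * g, mul_ne_zero hf hg, ?_⟩
    rw [mul_add]
    refine add_mem ?_ ?_
    · rw [mul_comm f, map_mul, mul_assoc]
      exact Ideal.mul_mem_left _ _ hf'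
    · rw [map_mul, mul_assoc]
      exact Ideal.mul_mem_left _ _ hg'
  | mulOp_mul g P hP =>
    obtain ⟨f, hf, hf'⟩ := hP
    refine ⟨f, hf, ?_⟩
    rw [← mul_assoc, ← map_mul, mul_comm, map_mul, mul_assoc]
    exact Ideal.mul_mem_left _ _ hf'
  | dOp_mul j P hP =>
    obtain ⟨f, hf, hf'⟩ := hP
    refine ⟨f * f, mul_ne_zero hf hf, ?_⟩
    -- Leibniz: f² ∂_j = (f ∂_j - f_j) f, where f_j is the x_j-derivative of f.
    have : mulOp n (f * f) * (dOp j * P) =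
        (mulOp n f * dOp j - mulOp n (pderiv j f)) * (mulOp n f * P) := by
      rw [sub_mul, ← mul_assoc (mulOp n f * dOp j), mul_assoc (mulOp n f), dOp_mul_mulOp, mul_add,
        add_mul, map_mul, ← mul_assoc (mulOp n (pderiv j f)), ← map_mul (mulOp n) (pderiv j f),
        ← map_mul (mulOp n) f (pderiv j f), mul_comm (pderiv j f), add_sub_cancel_right]
      simp only [mul_assoc]
    rw [this]
    exact Ideal.mul_mem_left _ _ hf'

theorem holonomicRank_span_supportOp (S : Finset (Fin n →₀ ℕ)) :
    holonomicRank (Ideal.span (Set.range (supportOp S))) = ((S.card ^ n : ℕ) : Cardinal) := by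
  rcases S.eq_empty_or_nonempty with rfl | hS
  · rcases Nat.eq_zero_or_pos n with rfl | hn
    -- With no variables there are no generators, so S may be replaced by a nonempty set; this is
    -- the case 0^0 = 1.
    · have h : supportOp (∅ : Finset (Fin 0 →₀ ℕ)) = supportOp {0} := Subsingleton.elim _ _
      rw [h, holonomicRank_span_supportOp_of_nonempty (Finset.singleton_nonempty 0)]
      simp
    · rw [Finset.card_empty, zero_pow hn.ne', Nat.cast_zero, holonomicRank_eq_rank]
      refine rank_eq_zero_iff.2 fun x => ?_
      obtain ⟨P, rfl⟩ := Submodule.Quotient.mk_surjective _ x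
      have h1 : mulOp n (X ⟨0, hn⟩ - 1) ∈
          Ideal.span (Set.range (supportOp (∅ : Finset (Fin n →₀ ℕ)))) :=
        Ideal.subset_span ⟨⟨0, hn⟩, by simp [supportOp_eq, totalPoly, coordPoly]⟩
      have h2 : (X ⟨0, hn⟩ - 1 : MvPolynomial (Fin n) ℂ) ≠ 0 := fun h => by
        simpa using congrArg constantCoeff h
      obtain ⟨f, hf, hf'⟩ := exists_smul_mem_of_mulOp_mem h2 h1 P
      refine ⟨f, hf, ?_⟩
      rw [← Submodule.Quotient.mk_smul, Submodule.Quotient.mk_eq_zero]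
      exact hf'
  · exact holonomicRank_span_supportOp_of_nonempty hS

end Horn
end

/-! ### The main theorem -/

theorem mainTheorem3 (n : ℕ) (p : MvPolynomial (Fin n) ℂ) :
    (∃ φ : Horn.OreSatoCoeff n,
      n ≤ Fintype.card φ.ι ∧
      φ.IsNonconfluent ∧
      Horn.IsHolonomic φ.hornIdeal ∧
      Horn.holonomicRank φ.hornIdeal < Cardinal.aleph0 ∧
      φ.IsSolution p ∧
      ∀ i j, Commute (φ.hornOp i) (φ.hornOp j)) ∧
    ((Horn.OreSatoCoeff.ofSupport p.support).IsNonconfluent ∧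
      (Horn.OreSatoCoeff.ofSupport p.support).hornIdeal =
        Ideal.span (Set.range (Horn.supportOp p.support)) ∧
      Horn.IsHolonomic (Horn.OreSatoCoeff.ofSupport p.support).hornIdeal ∧
      Horn.holonomicRank (Horn.OreSatoCoeff.ofSupport p.support).hornIdeal =
        ((p.support.card ^ n : ℕ) : Cardinal) ∧
      (Horn.OreSatoCoeff.ofSupport p.support).IsSolution p ∧
      ∀ i j, Commute (Horn.supportOp p.support i) (Horn.supportOp p.support j)) := by
  classical
  -- Adjoining the exponent 0 makes the set nonempty even for p = 0, so that the number (n+1)#S of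
  -- Gamma factors is at least n.
  refine ⟨⟨Horn.OreSatoCoeff.ofSupport (insert 0 p.support), ?_,
    Horn.OreSatoCoeff.isNonconfluent_ofSupport _, ?_, ?_,
    Horn.OreSatoCoeff.isSolution_ofSupport (Finset.subset_insert _ _),
    Horn.OreSatoCoeff.commute_hornOp_ofSupport _⟩,
    Horn.OreSatoCoeff.isNonconfluent_ofSupport _, Horn.OreSatoCoeff.hornIdeal_ofSupport _, ?_, ?_,
    Horn.OreSatoCoeff.isSolution_ofSupport subset_rfl, Horn.commute_supportOp _⟩
  · rw [Horn.OreSatoCoeff.card_ofSupport]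
    exact n.le_succ.trans (Nat.le_mul_of_pos_right _ (Finset.insert_nonempty _ _).card_pos)
  · rw [Horn.OreSatoCoeff.hornIdeal_ofSupport]
    exact Horn.isHolonomic_span_supportOp _
  · rw [Horn.OreSatoCoeff.hornIdeal_ofSupport, Horn.holonomicRank_span_supportOp]
    exact Cardinal.natCast_lt_aleph0
  · rw [Horn.OreSatoCoeff.hornIdeal_ofSupport]
    exact Horn.isHolonomic_span_supportOp _
  · rw [Horn.OreSatoCoeff.hornIdeal_ofSupport]
    exact Horn.holonomicRank_span_supportOp _
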